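/- Let $u,v$ be integers with $v\ge u\ge 9$, let $\tau_1=[\overline{u,v}]=u+\cfrac{1}{v+\cfrac{1}{u+\cdots}}$ and $\tau_2=[\overline{v,u}]$, and let $\varphi=(1+\sqrt5)/2$. For a real quadratic irrational number $x$ let $x^{\sigma}$ denote its Galois conjugate over $\mathbb{Q}$. For a real quadratic irrational number $\alpha$ let $\Theta_\alpha=PSL(2,\mathbb{Z})\{\alpha,\alpha^\sigma\}$ be the union of the orbits of $\alpha$ and $\alpha^\sigma$ under fractional linear transformations, and for a real number $\xi\notin\mathbb{Q}\cup\Theta_\alpha$ put $$c_\alpha(\xi)=\liminf_{\beta\in\Theta_\alpha,\ |\beta-\beta^\sigma|\to0}2\,\frac{|\xi-\beta|}{|\beta-\beta^\sigma|}.$$ Let $Sp_\alpha=\{c_\alpha(\xi):\xi\in\mathbb{R}\setminus(\mathbb{Q}\cup\Theta_\alpha)\}$ be the quadratic Lagrange spectrum of $\alpha$; its maximum $K_\alpha$ is called the Hurwitz constant of $\alpha$. Then, for $\beta_{u,v}=[\overline{u,v}]$, the maximum of $Sp_{\beta_{u,v}}$ exists and $$K_{\beta_{u,v}}=\frac{2(\tau_1-\varphi^2)\left(1+\frac{\tau_2}{\varphi^2}\right)}{\left(\varphi+\frac1\varphi\right)(\tau_1\tau_2+1)}.$$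 Moreover $\varphi\notin\mathbb{Q}\cup\Theta_{\tau_1}$ and $K_{\beta_{u,v}}=c_{\tau_1}(\varphi)$, so the maximum is attained at $\varphi$. -/

import Mathlib

open Filter Topology

noncomputable section

/-- The finite continued fraction `[a₀, a₁, …, aₙ] = a₀ + 1 / (a₁ + 1 / (⋯ + 1 / aₙ))`. -/
def finCF (a : ℕ → ℕ) : ℕ → ℝ
  | 0 => (a 0 : ℝ)
  | n + 1 => (a 0 : ℝ) + 1 / finCF (fun k => a (k + 1)) n

/-- The infinite continued fraction `[a₀, a₁, a₂, …]`: the limit of the finite ones. -/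
def infCF (a : ℕ → ℕ) : ℝ := limUnder atTop (finCF a)

/-- The sequence `u, v, u, v, …`. -/
def altSeq (u v : ℕ) (n : ℕ) : ℕ := if Even n then u else v

/-- The purely periodic continued fraction `[u, v, u, v, …]`. -/
def betaCF (u v : ℕ) : ℝ := infCF (altSeq u v)

/-- The Galois conjugate over `ℚ` of a real quadratic irrational number `x`: the other root of its
minimal polynomial `X ^ 2 + b * X + c`, that is `-b - x`. -/
def galConj (x : ℝ) : ℝ := -(((minpoly ℚ x).coeff 1 : ℚ) : ℝ) - x

/-- The fractional linear action of `SL(2, ℤ)` (equivalently of `PSL(2, ℤ)`) on irrational reals. -/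
def moebius (g : Matrix.SpecialLinearGroup (Fin 2) ℤ) (x : ℝ) : ℝ :=
  ((g 0 0 : ℝ) * x + (g 0 1 : ℝ)) / ((g 1 0 : ℝ) * x + (g 1 1 : ℝ))

/-- `Θ_α`, the union of the `PSL(2, ℤ)`-orbits of `α` and of its Galois conjugate. -/
def orbitTheta (α : ℝ) : Set ℝ :=
  {β | ∃ g : Matrix.SpecialLinearGroup (Fin 2) ℤ, β = moebius g α ∨ β = moebius g (galConj α)}

/-- The lower limit `c_α(ξ)` of `2 |ξ - β| / |β - β^σ|` over `β ∈ Θ_α`, `|β - β^σ| → 0`, taken in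
the extended reals so that no boundedness is presupposed. -/
def approxConst (α ξ : ℝ) : EReal :=
  liminf (fun β : ℝ => ((2 * (|ξ - β| / |β - galConj β|) : ℝ) : EReal))
    (comap (fun β : ℝ => |β - galConj β|) (𝓝 0) ⊓ 𝓟 (orbitTheta α))

/-- The quadratic Lagrange spectrum `Sp_α`: all `c_α(ξ)`, for real `ξ` not in `ℚ ∪ Θ_α`. -/
def quadLagrangeSpectrum (α : ℝ) : Set EReal :=
  {c | ∃ ξ : ℝ, Irrational ξ ∧ ξ ∉ orbitTheta α ∧ approxConst α ξ = c}

/-- `K` is the Hurwitz constant of `α`: the maximum of `Sp_α`. -/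
def IsHurwitzConstant (α K : ℝ) : Prop := IsGreatest (quadLagrangeSpectrum α) (K : EReal)

/-- For a quadratic number `x`, `galConj x` is indeed the other root of the minimal polynomial. -/
theorem minpoly_eq_mul_galConj (x : ℝ) (hx : (minpoly ℚ x).natDegree = 2) :
    (minpoly ℚ x).map (algebraMap ℚ ℝ) =
      (Polynomial.X - Polynomial.C x) * (Polynomial.X - Polynomial.C (galConj x)) := by
  have hint : IsIntegral ℚ x := by
    by_contra h
    rw [minpoly.eq_zero h] at hx
    simp at hx
  have hmon := minpoly.monic hint
  have h2 : (minpoly ℚ x).coeff 2 = 1 := by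
    have := hmon.coeff_natDegree
    rwa [hx] at this
  have hroot := minpoly.aeval ℚ x
  rw [Polynomial.aeval_eq_sum_range, hx] at hroot
  simp only [Finset.sum_range_succ, Finset.sum_range_zero, h2, Algebra.smul_def] at hroot
  simp at hroot
  have hform : minpoly ℚ x = Polynomial.X ^ 2 + Polynomial.C ((minpoly ℚ x).coeff 1) *
      Polynomial.X + Polynomial.C ((minpoly ℚ x).coeff 0) := by
    conv_lhs => rw [Polynomial.as_sum_range_C_mul_X_pow (minpoly ℚ x), hx]
    simp only [Finset.sum_range_succ, Finset.sum_range_zero, h2]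
    simp
    ring
  have h0 : ((minpoly ℚ x).coeff 0 : ℝ) = x * galConj x := by
    unfold galConj
    linear_combination hroot
  rw [hform]
  simp only [Polynomial.map_add, Polynomial.map_mul, Polynomial.map_pow, Polynomial.map_X,
    Polynomial.map_C]
  simp only [eq_ratCast, h0]
  have h1 : ((minpoly ℚ x).coeff 1 : ℝ) = -x - galConj x := by
    unfold galConj
    ring
  rw [h1]
  simp only [map_sub, map_neg, map_mul]
  ring

/-- The continued fraction `[u, v, u, v, …]` with positive `u`, `v` converges. -/
theorem tendsto_betaCF (u v : ℕ) (hu : 1 ≤ u) (hv : 1 ≤ v) :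
    Tendsto (finCF (altSeq u v)) atTop (𝓝 (betaCF u v)) := by
  refine tendsto_nhds_limUnder ?_
  have hs : ∀ u v : ℕ, (fun k => altSeq u v (k + 1)) = altSeq v u := by
    intro u v
    funext k
    simp only [altSeq, Nat.even_add_one]
    by_cases h : Even k <;> simp [h]
  have hrec : ∀ u v n : ℕ, finCF (altSeq u v) (n + 1) = u + 1 / finCF (altSeq v u) n := by
    intro u v n
    rw [finCF, hs]
    simp [altSeq]
  have hone : ∀ n u v : ℕ, 1 ≤ u → 1 ≤ v → 1 ≤ finCF (altSeq u v) n := by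
    intro n
    induction n with
    | zero =>
      intro u v hu hv
      simpa [finCF, altSeq] using hu
    | succ n ih =>
      intro u v hu hv
      rw [hrec]
      have h1 := ih v u hv hu
      have h2 : (0 : ℝ) ≤ 1 / finCF (altSeq v u) n := by positivity
      have h3 : (1 : ℝ) ≤ u := by exact_mod_cast hu
      linarith
  have hu' : (1 : ℝ) ≤ u := by exact_mod_cast hu
  have hv' : (1 : ℝ) ≤ v := by exact_mod_cast hv
  obtain ⟨x, y, hx, hy, hxy, hyx⟩ : ∃ x y : ℝ, 1 < x ∧ 1 < y ∧ x = u + 1 / y ∧ y = v + 1 / x := by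
    set s := Real.sqrt ((u : ℝ) ^ 2 * v ^ 2 + 4 * u * v) with hsdef
    have hs2 : s ^ 2 = (u : ℝ) ^ 2 * v ^ 2 + 4 * u * v := Real.sq_sqrt (by positivity)
    have hs0 : 0 ≤ s := Real.sqrt_nonneg _
    have hsgt : (u : ℝ) * v < s := by
      rw [hsdef]
      apply Real.lt_sqrt_of_sq_lt
      nlinarith [mul_pos (lt_of_lt_of_le one_pos hu') (lt_of_lt_of_le one_pos hv')]
    have hvx : ((u : ℝ) * v + s) / (2 * v) > u := by
      rw [gt_iff_lt, lt_div_iff₀ (by positivity)]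
      nlinarith
    have hvy : ((u : ℝ) * v + s) / (2 * u) > v := by
      rw [gt_iff_lt, lt_div_iff₀ (by positivity)]
      nlinarith
    have hp : (u : ℝ) * v + s ≠ 0 := by positivity
    refine ⟨((u : ℝ) * v + s) / (2 * v), ((u : ℝ) * v + s) / (2 * u), by linarith, by linarith,
      ?_, ?_⟩
    · field_simp
      linear_combination hs2
    · field_simp
      linear_combination hs2
  set q := max (1 / x) (1 / y) with hq
  have hq0 : 0 ≤ q := le_max_of_le_left (by positivity)
  have hq1 : q < 1 := by
    rw [hq, max_lt_iff]
    exact ⟨by rw [div_lt_one (by linarith)]; exact hx, by rw [div_lt_one (by linarith)]; exact hy⟩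
  have hstep : ∀ c z : ℝ, 1 ≤ c → 1 < z → 1 / z ≤ q → |1 / c - 1 / z| ≤ q * |c - z| := by
    intro c z hc hz hzq
    have e : 1 / c - 1 / z = -((1 / c) * (1 / z) * (c - z)) := by
      field_simp
      ring
    rw [e, abs_neg, abs_mul, abs_of_nonneg (by positivity : (0 : ℝ) ≤ 1 / c * (1 / z))]
    apply mul_le_mul_of_nonneg_right _ (abs_nonneg _)
    have : 1 / c ≤ 1 := by rw [div_le_one (by linarith)]; exact hc
    calc 1 / c * (1 / z) ≤ 1 * (1 / z) := by gcongr
      _ ≤ q := by linarith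
  set E := max |(u : ℝ) - x| |(v : ℝ) - y| with hE
  have hbound : ∀ n, |finCF (altSeq u v) n - x| ≤ q ^ n * E ∧
      |finCF (altSeq v u) n - y| ≤ q ^ n * E := by
    intro n
    induction n with
    | zero => simp [finCF, altSeq, hE]
    | succ n ih =>
      constructor
      · have h1 := hstep _ y (hone n v u hv hu) hy (le_max_right _ _)
        have h2 : finCF (altSeq u v) (n + 1) - x = 1 / finCF (altSeq v u) n - 1 / y := by
          rw [hrec]
          linarith
        rw [h2, pow_succ]
        nlinarith [mul_le_mul_of_nonneg_left ih.2 hq0]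
      · have h1 := hstep _ x (hone n u v hu hv) hx (le_max_left _ _)
        have h2 : finCF (altSeq v u) (n + 1) - y = 1 / finCF (altSeq u v) n - 1 / x := by
          rw [hrec]
          linarith
        rw [h2, pow_succ]
        nlinarith [mul_le_mul_of_nonneg_left ih.1 hq0]
  refine ⟨x, ?_⟩
  rw [tendsto_iff_norm_sub_tendsto_zero]
  refine squeeze_zero (fun n => norm_nonneg _) (fun n => (hbound n).1) ?_
  simpa using (tendsto_pow_atTop_nhds_zero_of_lt_one hq0 hq1).mul_const E

end

/-!
Let `x = [u, v, u, …]` and `y = [v, u, v, …]`; the Galois conjugate of `x` is `-1 / y`.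

*Lower bound at `φ`.* For `β = A x` with `A ∈ GL(2, ℤ)`, the quantity
`2 (β - φ) (β^σ - ψ) / (β - β^σ)` is, up to normalization, `P ± T`, where `T > 0` depends only on
`u` and `v` and `P` is the integer pairing of the annihilating form of `x` with a form of
discriminant `5`. Two reflections preserve the pairing, and descent along them shows that `|P|`
avoids an interval around `T`. The nearest possible value `|P| = 3 u v + 2 u - 2 v` gives the
Hurwitz constant, since `|β^σ - ψ|` is close to `|φ - ψ|` when `β` is close to `φ` and `β^σ` to `β`.

*Upper bound at every irrational `ξ`.* A convergent matrix carries a complete quotient `Xₙ` to `ξ`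
and preserves `Θ_x`, so it suffices to approximate infinitely many `Xₙ` by one of the numbers
`k + 1 / x`, `k + 1 / y`, `k - 1 / x` of `Θ_x`. There is room to spare if infinitely many partial
quotients are at least `3`, or if eventually all are at most `2` and infinitely many equal `2`.
Otherwise they are eventually all `1`, so `Xₙ = φ` eventually, and `2 + 1 / y` gives exactly the
constant in the limit.
-/

open scoped goldenRatio

/-- The denominator of the fractional linear map of an integral `2 × 2` matrix. -/
def fracLinDenom (A : Matrix (Fin 2) (Fin 2) ℤ) (x : ℝ) : ℝ := A 1 0 * x + A 1 1

/-- The fractional linear map of an integral `2 × 2` matrix, which extends `moebius` from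
`SL(2, ℤ)` to all matrices; its value at a pole is `0`. -/
noncomputable def fracLin (A : Matrix (Fin 2) (Fin 2) ℤ) (x : ℝ) : ℝ :=
  (A 0 0 * x + A 0 1) / fracLinDenom A x

section FracLin

variable {A B : Matrix (Fin 2) (Fin 2) ℤ} {x y b b' : ℝ}

theorem fracLinDenom_ne_zero (hA : A.det ≠ 0) (hx : Irrational x) : fracLinDenom A x ≠ 0 := by
  by_cases hc : A 1 0 = 0
  · have hd : A 1 1 ≠ 0 := fun hd => hA (by simp [Matrix.det_fin_two, hc, hd])
    simpa [fracLinDenom, hc] using hd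
  · exact ((hx.intCast_mul hc).add_intCast _).ne_zero

theorem fracLinDenom_mul (hx : fracLinDenom B x ≠ 0) :
    fracLinDenom (A * B) x = fracLinDenom A (fracLin B x) * fracLinDenom B x := by
  unfold fracLinDenom fracLin at *
  simp only [Matrix.mul_apply, Fin.sum_univ_two, fracLinDenom]
  push_cast
  field_simp
  ring

theorem fracLin_mul (hx : fracLinDenom B x ≠ 0) :
    fracLin (A * B) x = fracLin A (fracLin B x) := by
  have hnum : ((A * B) 0 0 * x + (A * B) 0 1 : ℝ) =
      (A 0 0 * fracLin B x + A 0 1) * fracLinDenom B x := by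
    unfold fracLin
    simp only [Matrix.mul_apply, Fin.sum_univ_two]
    push_cast
    field_simp
    unfold fracLinDenom
    ring
  rw [fracLin, hnum, fracLinDenom_mul hx, mul_div_mul_right _ _ hx, ← fracLin]

theorem fracLin_adjugate_fracLin (hA : A.det ≠ 0) (hx : fracLinDenom A x ≠ 0) :
    fracLin A.adjugate (fracLin A x) = x := by
  rw [← fracLin_mul hx, Matrix.adjugate_mul]
  have : (A.det : ℝ) ≠ 0 := mod_cast hA
  simp [fracLin, fracLinDenom, this]

theorem irrational_fracLin (hA : A.det ≠ 0) (hx : Irrational x) : Irrational (fracLin A x) := by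
  rintro ⟨q, hq⟩
  refine hx ⟨(A.adjugate 0 0 * q + A.adjugate 0 1) / (A.adjugate 1 0 * q + A.adjugate 1 1), ?_⟩
  rw [← fracLin_adjugate_fracLin hA (fracLinDenom_ne_zero hA hx), ← hq]
  push_cast
  rfl

theorem fracLin_sub_fracLin (hx : fracLinDenom A x ≠ 0) (hy : fracLinDenom A y ≠ 0) :
    fracLin A x - fracLin A y = A.det * (x - y) / (fracLinDenom A x * fracLinDenom A y) := by
  rw [fracLin, fracLin, div_sub_div _ _ hx hy, Matrix.det_fin_two]
  unfold fracLinDenom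
  push_cast
  ring

theorem abs_fracLin_sub_fracLin (hA : IsUnit A.det) (hx : fracLinDenom A x ≠ 0)
    (hy : fracLinDenom A y ≠ 0) :
    |fracLin A x - fracLin A y| = |x - y| / |fracLinDenom A x * fracLinDenom A y| := by
  have hdet : |(A.det : ℝ)| = 1 := mod_cast Int.isUnit_iff_abs_eq.mp hA
  rw [fracLin_sub_fracLin hx hy, abs_div, abs_mul, hdet, one_mul]

theorem abs_fracLin_sub_div_abs_fracLin_sub (hA : IsUnit A.det) (hx : fracLinDenom A x ≠ 0)
    (hb : fracLinDenom A b ≠ 0) (hb' : fracLinDenom A b' ≠ 0) :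
    |fracLin A x - fracLin A b| / |fracLin A b - fracLin A b'| =
      |x - b| * |fracLinDenom A b'| / (|fracLinDenom A x| * |b - b'|) := by
  rw [abs_fracLin_sub_fracLin hA hx hb, abs_fracLin_sub_fracLin hA hb hb', abs_mul, abs_mul,
    div_div_div_eq]
  rw [show |x - b| * (|fracLinDenom A b| * |fracLinDenom A b'|) =
      |fracLinDenom A b| * (|x - b| * |fracLinDenom A b'|) by ring,
    show |fracLinDenom A x| * |fracLinDenom A b| * |b - b'| =
      |fracLinDenom A b| * (|fracLinDenom A x| * |b - b'|) by ring,
    mul_div_mul_left _ _ (abs_ne_zero.mpr hb)]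

end FracLin

/-- `x` is a quadratic irrational number with Galois conjugate `x'`, expressed through the
rationality of the trace and the norm. -/
structure IsGaloisPair (x x' : ℝ) : Prop where
  irrational : Irrational x
  exists_add_eq : ∃ s : ℚ, x + x' = s
  exists_mul_eq : ∃ p : ℚ, x * x' = p

namespace IsGaloisPair

variable {x x' : ℝ}

theorem irrational_right (h : IsGaloisPair x x') : Irrational x' := by
  obtain ⟨s, hs⟩ := h.exists_add_eq
  rw [← eq_sub_iff_add_eq'] at hs
  exact hs ▸ h.irrational.ratCast_sub s

theorem ne (h : IsGaloisPair x x') : x ≠ x' := by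
  rintro rfl
  obtain ⟨s, hs⟩ := h.exists_add_eq
  exact h.irrational ⟨s / 2, by push_cast; linarith⟩

theorem galConj_eq (h : IsGaloisPair x x') : galConj x = x' := by
  obtain ⟨s, hs⟩ := h.exists_add_eq
  obtain ⟨p, hp⟩ := h.exists_mul_eq
  set f : Polynomial ℚ := Polynomial.X ^ 2 + (Polynomial.C (-s) * Polynomial.X + Polynomial.C p)
    with hf
  have hlt : (Polynomial.C (-s) * Polynomial.X + Polynomial.C p).degree < ((2 : ℕ) : WithBot ℕ) :=
    Polynomial.degree_linear_le.trans_lt (by norm_num)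
  have hmonic : f.Monic := Polynomial.monic_X_pow_add hlt
  have hroot : Polynomial.aeval x f = 0 := by
    simp only [hf, map_add, map_mul, map_neg, map_pow, Polynomial.aeval_X, Polynomial.aeval_C,
      eq_ratCast, ← hs, ← hp]
    ring
  have hint : IsIntegral ℚ x := ⟨f, hmonic, hroot⟩
  have htwo : 2 ≤ (minpoly ℚ x).natDegree := by
    rw [minpoly.two_le_natDegree_iff hint]
    rintro ⟨q, hq⟩
    exact h.irrational ⟨q, hq⟩
  have hmin : f = minpoly ℚ x := by
    refine Polynomial.eq_of_monic_of_dvd_of_natDegree_le (minpoly.monic hint) hmonic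
      (minpoly.dvd ℚ x hroot) (le_of_eq_of_le ?_ htwo)
    rw [hf, Polynomial.natDegree_add_eq_left_of_degree_lt (by rwa [Polynomial.degree_X_pow]),
      Polynomial.natDegree_X_pow]
  have hcoeff : f.coeff 1 = -s := by simp [hf, Polynomial.coeff_X_pow]
  rw [galConj, ← hmin, hcoeff]
  push_cast
  linarith

theorem map_fracLin (h : IsGaloisPair x x') {A : Matrix (Fin 2) (Fin 2) ℤ} (hA : A.det ≠ 0) :
    IsGaloisPair (fracLin A x) (fracLin A x') := by
  obtain ⟨s, hs⟩ := h.exists_add_eq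
  obtain ⟨p, hp⟩ := h.exists_mul_eq
  have hx := fracLinDenom_ne_zero hA h.irrational
  have hx' := fracLinDenom_ne_zero hA h.irrational_right
  have hnorm : fracLinDenom A x * fracLinDenom A x' =
      A 1 0 ^ 2 * p + A 1 0 * A 1 1 * s + A 1 1 ^ 2 := by
    unfold fracLinDenom
    rw [← hs, ← hp]
    ring
  refine ⟨irrational_fracLin hA h.irrational,
    ⟨(2 * A 0 0 * A 1 0 * p + (A 0 0 * A 1 1 + A 0 1 * A 1 0) * s + 2 * A 0 1 * A 1 1) /
      (A 1 0 ^ 2 * p + A 1 0 * A 1 1 * s + A 1 1 ^ 2), ?_⟩,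
    ⟨(A 0 0 ^ 2 * p + A 0 0 * A 0 1 * s + A 0 1 ^ 2) /
      (A 1 0 ^ 2 * p + A 1 0 * A 1 1 * s + A 1 1 ^ 2), ?_⟩⟩
  · push_cast
    rw [← hnorm, fracLin, fracLin, div_add_div _ _ hx hx', ← hs, ← hp]
    unfold fracLinDenom
    ring
  · push_cast
    rw [← hnorm, fracLin, fracLin, div_mul_div_comm, ← hs, ← hp]
    ring

end IsGaloisPair

section Orbit

variable {A : Matrix (Fin 2) (Fin 2) ℤ} {α α' β : ℝ} {n : ℤ}

theorem fracLin_reflection (n : ℤ) (x : ℝ) : fracLin !![-1, n; 0, 1] x = n - x := by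
  simp [fracLin, fracLinDenom, neg_add_eq_sub]

/-- The matrix `!![-1, n; 0, 1]` of determinant `-1` exchanges `α` and `α'`, so that `Θ_α` is a
single orbit under `GL(2, ℤ)`. -/
theorem mem_orbitTheta_iff (h : IsGaloisPair α α') (hn : α + α' = n) :
    β ∈ orbitTheta α ↔ ∃ A : Matrix (Fin 2) (Fin 2) ℤ, IsUnit A.det ∧ fracLin A α = β := by
  have hden (x : ℝ) : fracLinDenom !![-1, n; 0, 1] x ≠ 0 := by simp [fracLinDenom]
  have hα : fracLin !![-1, n; 0, 1] α = α' := by rw [fracLin_reflection, ← hn]; ring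
  have hα' : fracLin !![-1, n; 0, 1] α' = α := by rw [fracLin_reflection, ← hn]; ring
  constructor
  · rintro ⟨g, rfl | rfl⟩
    · exact ⟨g, by simp, rfl⟩
    · refine ⟨g * !![-1, n; 0, 1], by simp [Matrix.det_fin_two_of], ?_⟩
      rw [fracLin_mul (hden α), hα, h.galConj_eq]
      rfl
  · rintro ⟨A, hA, rfl⟩
    rcases Int.isUnit_iff.mp hA with hdet | hdet
    · exact ⟨⟨A, hdet⟩, Or.inl rfl⟩
    · refine ⟨⟨A * !![-1, n; 0, 1], by simp [Matrix.det_fin_two_of, hdet]⟩, Or.inr ?_⟩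
      calc fracLin A α = fracLin (A * !![-1, n; 0, 1]) α' := by rw [fracLin_mul (hden α'), hα']
        _ = moebius _ (galConj α) := by rw [h.galConj_eq]; rfl

theorem isGaloisPair_of_mem_orbitTheta (h : IsGaloisPair α α') (hn : α + α' = n)
    (hβ : β ∈ orbitTheta α) : IsGaloisPair β (galConj β) := by
  obtain ⟨A, hA, rfl⟩ := (mem_orbitTheta_iff h hn).mp hβ
  have := h.map_fracLin hA.ne_zero
  rwa [this.galConj_eq]

theorem fracLin_mem_orbitTheta (h : IsGaloisPair α α') (hn : α + α' = n) (hA : IsUnit A.det)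
    (hβ : β ∈ orbitTheta α) : fracLin A β ∈ orbitTheta α := by
  rw [mem_orbitTheta_iff h hn] at hβ ⊢
  obtain ⟨B, hB, rfl⟩ := hβ
  exact ⟨A * B, by rw [Matrix.det_mul]; exact hA.mul hB,
    fracLin_mul (fracLinDenom_ne_zero hB.ne_zero h.irrational)⟩

end Orbit

section AlternatingCF

theorem finCF_nonneg (a : ℕ → ℕ) (n : ℕ) : 0 ≤ finCF a n := by
  induction n generalizing a with
  | zero => exact Nat.cast_nonneg _
  | succ n ih => exact add_nonneg (Nat.cast_nonneg _) (one_div_nonneg.mpr (ih _))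

theorem natCast_le_finCF (a : ℕ → ℕ) (n : ℕ) : (a 0 : ℝ) ≤ finCF a n := by
  cases n with
  | zero => exact le_rfl
  | succ n => exact le_add_of_nonneg_right (one_div_nonneg.mpr (finCF_nonneg _ n))

theorem altSeq_succ (u v : ℕ) : (fun k => altSeq u v (k + 1)) = altSeq v u := by
  funext k
  by_cases h : Even k <;> simp [altSeq, Nat.even_add_one, h]

theorem natCast_le_betaCF {u v : ℕ} (hu : 1 ≤ u) (hv : 1 ≤ v) : (u : ℝ) ≤ betaCF u v :=
  ge_of_tendsto' (tendsto_betaCF u v hu hv) fun n => by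
    simpa [altSeq] using natCast_le_finCF (altSeq u v) n

theorem betaCF_eq {u v : ℕ} (hu : 1 ≤ u) (hv : 1 ≤ v) :
    betaCF u v = u + 1 / betaCF v u := by
  have hpos : (0 : ℝ) < betaCF v u := (Nat.cast_pos.mpr hv).trans_le (natCast_le_betaCF hv hu)
  have hlim : Tendsto (fun n => (u : ℝ) + 1 / finCF (altSeq v u) n) atTop
      (𝓝 (u + 1 / betaCF v u)) :=
    tendsto_const_nhds.add (tendsto_const_nhds.div (tendsto_betaCF v u hv hu) hpos.ne')
  refine tendsto_nhds_unique ((tendsto_betaCF u v hu hv).comp (tendsto_add_atTop_nat 1))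
    (hlim.congr fun n => ?_)
  rw [Function.comp_apply, finCF, altSeq_succ]
  simp [altSeq]

/-- `x` and `y` are the purely periodic continued fractions `[u, v, u, v, …]` and
`[v, u, v, u, …]` with positive partial quotients, characterized by their fixed point equations. -/
structure IsAlternatingCF (u v : ℕ) (x y : ℝ) : Prop where
  quot_left_pos : 0 < u
  quot_right_pos : 0 < v
  left_pos : 0 < x
  right_pos : 0 < y
  left_eq : x = u + 1 / y
  right_eq : y = v + 1 / x

theorem isAlternatingCF_betaCF {u v : ℕ} (hu : 1 ≤ u) (hv : 1 ≤ v) :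
    IsAlternatingCF u v (betaCF u v) (betaCF v u) where
  quot_left_pos := hu
  quot_right_pos := hv
  left_pos := (Nat.cast_pos.mpr hu).trans_le (natCast_le_betaCF hu hv)
  right_pos := (Nat.cast_pos.mpr hv).trans_le (natCast_le_betaCF hv hu)
  left_eq := betaCF_eq hu hv
  right_eq := betaCF_eq hv hu

namespace IsAlternatingCF

variable {u v : ℕ} {x y : ℝ}

theorem symm (h : IsAlternatingCF u v x y) : IsAlternatingCF v u y x :=
  ⟨h.quot_right_pos, h.quot_left_pos, h.right_pos, h.left_pos, h.right_eq, h.left_eq⟩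

theorem quot_left_lt (h : IsAlternatingCF u v x y) : (u : ℝ) < x := by
  rw [h.left_eq]
  exact lt_add_of_pos_right _ (one_div_pos.mpr h.right_pos)

theorem quot_left_mul (h : IsAlternatingCF u v x y) : u * y = x * y - 1 := by
  have hy := h.right_pos.ne'
  rw [h.left_eq]
  field_simp
  ring

theorem quot_right_mul (h : IsAlternatingCF u v x y) : v * x = x * y - 1 := by
  rw [h.symm.quot_left_mul, mul_comm]

theorem quot_left_sub (h : IsAlternatingCF u v x y) : u - x = -(1 / y) := by
  linarith [h.left_eq]

theorem mul_quot_left_sub (h : IsAlternatingCF u v x y) : v * (x * (u - x)) = -u := by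
  have hy := h.right_pos.ne'
  rw [h.quot_left_sub, ← mul_assoc, h.quot_right_mul, ← h.quot_left_mul]
  field_simp

theorem irrational_left (h : IsAlternatingCF u v x y) : Irrational x := by
  rintro ⟨t, rfl⟩
  have hroot : (v : ℚ) * (t * (u - t)) = -u := mod_cast h.mul_quot_left_sub
  have hsq : IsSquare ((u ^ 2 * v ^ 2 + 4 * u * v : ℕ) : ℚ) := by
    refine ⟨2 * v * t - u * v, ?_⟩
    push_cast
    linear_combination (4 * (v : ℚ)) * hroot
  rw [Rat.isSquare_natCast_iff] at hsq
  obtain ⟨k, hk⟩ := hsq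
  have huv : 0 < u * v := Nat.mul_pos h.quot_left_pos h.quot_right_pos
  have hlower : u * v + 1 < k := lt_of_mul_self_lt_mul_self₀ (Nat.zero_le _) (by nlinarith)
  have hupper : k < u * v + 2 := lt_of_mul_self_lt_mul_self₀ (Nat.zero_le _) (by nlinarith)
  omega

theorem isGaloisPair (h : IsAlternatingCF u v x y) : IsGaloisPair x (u - x) where
  irrational := h.irrational_left
  exists_add_eq := ⟨u, by push_cast; ring⟩
  exists_mul_eq := by
    have hv : (v : ℝ) ≠ 0 := Nat.cast_ne_zero.mpr h.quot_right_pos.ne'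
    refine ⟨-u / v, ?_⟩
    push_cast
    rw [eq_div_iff hv, mul_comm, h.mul_quot_left_sub]

theorem fracLin_mem (h : IsAlternatingCF u v x y) {A : Matrix (Fin 2) (Fin 2) ℤ}
    (hA : IsUnit A.det) :
    fracLin A x ∈ orbitTheta x ∧ galConj (fracLin A x) = fracLin A (u - x) :=
  ⟨(mem_orbitTheta_iff h.isGaloisPair (n := u) (by simp)).mpr ⟨A, hA, rfl⟩,
    (h.isGaloisPair.map_fracLin hA.ne_zero).galConj_eq⟩

theorem intCast_add_inv_left_mem (h : IsAlternatingCF u v x y) (k : ℤ) :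
    k + 1 / x ∈ orbitTheta x ∧ galConj (k + 1 / x) = k - y := by
  have hx := h.left_pos.ne'
  have hmem := h.fracLin_mem (A := !![k, 1; 1, 0]) (by simp [Matrix.det_fin_two_of])
  have hleft : fracLin !![k, 1; 1, 0] x = k + 1 / x := by
    simp [fracLin, fracLinDenom, add_div, hx]
  have hconj : fracLin !![k, 1; 1, 0] (u - x) = k - y := by
    have hy := h.right_pos.ne'
    simp [fracLin, fracLinDenom, h.quot_left_sub, add_div, hy, sub_eq_add_neg]
  rwa [hleft, hconj] at hmem

theorem intCast_add_inv_right_mem (h : IsAlternatingCF u v x y) (k : ℤ) :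
    k + 1 / y ∈ orbitTheta x ∧ galConj (k + 1 / y) = k - x := by
  have hmem := h.fracLin_mem (A := !![1, k - u; 0, 1]) (by simp [Matrix.det_fin_two_of])
  have hleft : fracLin !![1, k - u; 0, 1] x = k + 1 / y := by
    rw [← neg_eq_iff_eq_neg.mpr h.quot_left_sub]
    simp [fracLin, fracLinDenom, add_sub_left_comm]
  have hconj : fracLin !![1, k - u; 0, 1] (u - x) = k - x := by
    simp [fracLin, fracLinDenom]
  rwa [hleft, hconj] at hmem

theorem intCast_sub_inv_left_mem (h : IsAlternatingCF u v x y) (k : ℤ) :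
    k - 1 / x ∈ orbitTheta x ∧ galConj (k - 1 / x) = k + y := by
  have hx := h.left_pos.ne'
  have hmem := h.fracLin_mem (A := !![k, -1; 1, 0]) (by simp [Matrix.det_fin_two_of])
  have hleft : fracLin !![k, -1; 1, 0] x = k - 1 / x := by
    simp [fracLin, fracLinDenom, add_div, neg_div, hx, sub_eq_add_neg]
  have hconj : fracLin !![k, -1; 1, 0] (u - x) = k + y := by
    have hy := h.right_pos.ne'
    simp [fracLin, fracLinDenom, h.quot_left_sub, add_div, hy]
  rwa [hleft, hconj] at hmem

end IsAlternatingCF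

end AlternatingCF

section LowerBound

/-- The pairing of a binary quadratic form `p * X ^ 2 + q * X * Y + r * Y ^ 2` with the form
`v * X ^ 2 - u * v * X * Y - u * Y ^ 2` that annihilates `[u, v, u, v, …]`: it is, up to sign, the
joint invariant of the two forms under `GL(2, ℤ)`. -/
def pairing (u v p q r : ℤ) : ℤ := u * v * q + 2 * r * v - 2 * p * u

section Pairing

variable {u v p q r : ℤ}

theorem pairing_neg (u v p q r : ℤ) : pairing u v (-p) (-q) (-r) = -pairing u v p q r := by
  unfold pairing
  ring

theorem pairing_swap (u v p q r : ℤ) : pairing v u (-r) q (-p) = pairing u v p q r := by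
  unfold pairing
  ring

theorem pairing_reflect_left (u v p q r : ℤ) :
    pairing u v p (-q - 2 * p * u) (p * u ^ 2 + q * u + r) = pairing u v p q r := by
  unfold pairing
  ring

theorem pairing_reflect_right (u v p q r : ℤ) :
    pairing u v (r * v ^ 2 - q * v + p) (2 * r * v - q) r = pairing u v p q r := by
  unfold pairing
  ring

theorem le_pairing_of_pos (hu : 9 ≤ u) (hv : 9 ≤ v) (hp : 0 < p) (hr : 0 < r) (hq : 5 ≤ q)
    (hdisc : q ^ 2 - 4 * p * r = 5) (hred : 0 ≤ r * (r * v - q)) :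
    3 * u * v + 2 * u + 2 * v ≤ pairing u v p q r := by
  have huv : 9 * u ≤ u * v := by nlinarith
  have hrv : 2 * v ≤ 2 * r * v := by nlinarith
  unfold pairing
  rcases le_or_gt q 6 with hq6 | hq6
  · have hp7 : p ≤ 7 := by nlinarith
    nlinarith [mul_le_mul_of_nonneg_right hq (by positivity : 0 ≤ u * v)]
  · have hqrv : q ≤ r * v := sub_nonneg.mp (nonneg_of_mul_nonneg_right hred hr)
    have hp4 : 4 * p ≤ v * q := by
      refine le_of_mul_le_mul_right ?_ (by linarith : 0 < q)
      nlinarith [mul_le_mul_of_nonneg_left hqrv hp.le]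
    nlinarith [mul_le_mul_of_nonneg_left hp4 (by linarith : 0 ≤ u),
      mul_le_mul_of_nonneg_right (by linarith : 7 ≤ q) (by positivity : 0 ≤ u * v)]

theorem odd_of_disc_eq_five (hdisc : q ^ 2 - 4 * p * r = 5) : Odd q := by
  by_contra hq
  obtain ⟨k, rfl⟩ := Int.not_odd_iff_even.mp hq
  have : (4 : ℤ) ∣ 5 := ⟨k ^ 2 - p * r, by linarith⟩
  norm_num at this

theorem pairing_gap_of_reduced (hu : 9 ≤ u) (huv : u ≤ v) (hq : 0 < q)
    (hdisc : q ^ 2 - 4 * p * r = 5) (hp : 0 ≤ p * (p * u + q)) (hr : 0 ≤ r * (r * v - q)) :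
    3 * u * v + 2 * u - 2 * v ≤ |pairing u v p q r| ∨
      |pairing u v p q r| ≤ u * v + 2 * u + 2 * v := by
  have hv : 9 ≤ v := hu.trans huv
  have hqcases : q = 1 ∨ q = 3 ∨ 5 ≤ q := by
    obtain ⟨k, rfl⟩ := odd_of_disc_eq_five hdisc
    omega
  rcases hqcases with rfl | rfl | hq5
  · right
    have hpr : p * -r = 1 := by linarith
    have huv0 : 0 ≤ u * v := by positivity
    rw [pairing, abs_le]
    rcases Int.mul_eq_one_iff_eq_one_or_neg_one.mp hpr with ⟨rfl, h⟩ | ⟨rfl, h⟩ <;>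
      obtain rfl := neg_eq_iff_eq_neg.mp h <;> constructor <;> linarith
  · left
    refine le_trans ?_ (le_abs_self _)
    have hpr : p * r = 1 := by linarith
    rw [pairing]
    rcases Int.mul_eq_one_iff_eq_one_or_neg_one.mp hpr with ⟨rfl, rfl⟩ | ⟨rfl, rfl⟩ <;> linarith
  · left
    refine le_trans ?_ (le_abs_self _)
    rcases pos_and_pos_or_neg_and_neg_of_mul_pos (by nlinarith : 0 < p * r) with h | h
    · linarith [le_pairing_of_pos hu hv h.1 h.2 hq5 hdisc hr]
    · rw [← pairing_swap]
      linarith [le_pairing_of_pos hv hu (neg_pos.mpr h.2) (neg_pos.mpr h.1) hq5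
        (by linarith) (by linarith)]

/-- Descent: a form of discriminant `5` for which neither of the two reflections that preserve the
pairing decreases `|q|` is reduced. -/
theorem pairing_gap (hu : 9 ≤ u) (huv : u ≤ v) (hdisc : q ^ 2 - 4 * p * r = 5) :
    3 * u * v + 2 * u - 2 * v ≤ |pairing u v p q r| ∨
      |pairing u v p q r| ≤ u * v + 2 * u + 2 * v := by
  induction hn : q.natAbs using Nat.strong_induction_on generalizing p q r with
  | _ n ih =>
    subst hn
    by_cases hleft : (-q - 2 * p * u).natAbs < q.natAbs
    · rw [← pairing_reflect_left]
      exact ih _ hleft (by linear_combination hdisc) rfl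
    by_cases hright : (2 * r * v - q).natAbs < q.natAbs
    · rw [← pairing_reflect_right]
      exact ih _ hright (by linear_combination hdisc) rfl
    rw [Int.natAbs_lt_iff_sq_lt] at hleft hright
    have hp : 0 ≤ p * (p * u + q) := by
      by_contra hcon
      exact hleft (by nlinarith)
    have hr : 0 ≤ r * (r * v - q) := by
      by_contra hcon
      exact hright (by nlinarith)
    rcases lt_trichotomy q 0 with hq | rfl | hq
    · rw [← abs_neg, ← pairing_neg]
      exact pairing_gap_of_reduced hu huv (neg_pos.mpr hq) (by linear_combination hdisc)
        (by linarith) (by linarith)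
    · exact absurd (odd_of_disc_eq_five hdisc) (by decide)
    · exact pairing_gap_of_reduced hu huv hq hdisc hp hr

end Pairing

/-- The form paired with the annihilator of `x` is the pullback under `A` of the form
`X ^ 2 - X * Y - Y ^ 2` with the roots `φ` and `ψ`. -/
theorem mul_fracLin_sub_golden {A : Matrix (Fin 2) (Fin 2) ℤ} {u v : ℤ} {x x' : ℝ}
    (hadd : x + x' = u) (hmul : v * (x * x') = -u)
    (hx : fracLinDenom A x ≠ 0) (hx' : fracLinDenom A x' ≠ 0) :
    2 * v * ((fracLin A x - φ) * (fracLin A x' - ψ)) * (fracLinDenom A x * fracLinDenom A x') =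
      pairing u v (A 0 0 ^ 2 - A 0 0 * A 1 0 - A 1 0 ^ 2)
          (2 * A 0 0 * A 0 1 - A 0 0 * A 1 1 - A 0 1 * A 1 0 - 2 * A 1 0 * A 1 1)
          (A 0 1 ^ 2 - A 0 1 * A 1 1 - A 1 1 ^ 2) +
        A.det * ((φ - ψ) * (v * (x - x'))) := by
  have hnum : (fracLin A x - φ) * fracLinDenom A x =
      A 0 0 * x + A 0 1 - φ * fracLinDenom A x := by
    rw [fracLin, sub_mul, div_mul_cancel₀ _ hx]
  have hnum' : (fracLin A x' - ψ) * fracLinDenom A x' =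
      A 0 0 * x' + A 0 1 - ψ * fracLinDenom A x' := by
    rw [fracLin, sub_mul, div_mul_cancel₀ _ hx']
  calc 2 * v * ((fracLin A x - φ) * (fracLin A x' - ψ)) * (fracLinDenom A x * fracLinDenom A x')
      = 2 * v * (((fracLin A x - φ) * fracLinDenom A x) *
          ((fracLin A x' - ψ) * fracLinDenom A x')) := by ring
    _ = _ := by
      rw [hnum, hnum', Matrix.det_fin_two, pairing]
      unfold fracLinDenom
      push_cast
      linear_combination 2 * (A 0 0 ^ 2 - A 0 0 * A 1 0 - A 1 0 ^ 2 : ℝ) * hmul +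
        v * (2 * A 0 0 * A 0 1 - A 0 0 * A 1 1 - A 0 1 * A 1 0 - 2 * A 1 0 * A 1 1 : ℝ) * hadd -
        1 / 2 * v * ((A 1 0 * x + A 1 1) * (A 1 0 * x' + A 1 1)) *
          Real.sq_sqrt (show (0 : ℝ) ≤ 5 by norm_num)

/-- The Hurwitz constant of `x = [u, v, u, v, …]`, for `9 ≤ u ≤ v`, as a function of `x` and
`y = [v, u, v, u, …]`. -/
noncomputable def hurwitzValue (x y : ℝ) : ℝ :=
  2 * (x - φ ^ 2) * (1 + y / φ ^ 2) / ((φ + 1 / φ) * (x * y + 1))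

section HurwitzValue

variable {x y : ℝ}

theorem hurwitzValue_mul (h : x * y + 1 ≠ 0) :
    hurwitzValue x y * ((φ - ψ) * (x * y + 1)) = 2 * (x - φ ^ 2) * (1 + ψ ^ 2 * y) := by
  have hden : φ + 1 / φ = φ - ψ := by rw [one_div, Real.inv_goldenRatio, sub_eq_add_neg]
  have hsq : y / φ ^ 2 = ψ ^ 2 * y := by
    rw [div_eq_mul_inv, ← inv_pow, Real.inv_goldenRatio, neg_sq, mul_comm]
  have hφψ : φ - ψ ≠ 0 := by simp [Real.goldenRatio_sub_goldenConj]
  rw [hurwitzValue, hden, hsq, div_mul_cancel₀ _ (mul_ne_zero hφψ h)]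

theorem one_add_hurwitzValue_mul (h : x * y + 1 ≠ 0) :
    (1 + hurwitzValue x y) * ((φ - ψ) * (x * y + 1)) = 3 * (x * y - 1) + 2 * x - 2 * y := by
  rw [add_mul, hurwitzValue_mul h, Real.goldenRatio_sq, Real.goldenConj_sq]
  linear_combination y / 2 * Real.sq_sqrt (show (0 : ℝ) ≤ 5 by norm_num)

theorem three_halves_le_goldenRatio : 3 / 2 ≤ φ := by
  nlinarith [Real.goldenRatio_sq, Real.one_lt_goldenRatio]

theorem goldenRatio_le_thirteen_eighths : φ ≤ 13 / 8 := by
  nlinarith [Real.goldenRatio_sq, Real.one_lt_goldenRatio]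

/-- The constants come from `5 / 2 ≤ φ ^ 2 ≤ 8 / 3`. -/
theorem le_hurwitzValue_mul (hx : 8 / 3 ≤ x) (hy : 0 ≤ y) :
    (x - 8 / 3) * (y + 5 / 2) ≤ 3 * hurwitzValue x y * (x * y + 1) := by
  have hlow := three_halves_le_goldenRatio
  have hupp := goldenRatio_le_thirteen_eighths
  have hsq := Real.goldenRatio_sq
  have hval := hurwitzValue_mul (x := x) (y := y) (by positivity)
  rw [Real.goldenRatio_sq, Real.goldenConj_sq, ← Real.one_sub_goldenConj] at hval
  generalize φ = t at hlow hupp hsq hval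
  have hfactor : 1 + (1 - t + 1) * y = (2 - t) * (y + (t + 1)) := by linear_combination hsq
  have hprod : (x - 8 / 3) * (y + 5 / 2) ≤ (x - (t + 1)) * (y + (t + 1)) := by
    gcongr <;> linarith
  have hprod_nonneg : 0 ≤ (x - 8 / 3) * (y + 5 / 2) := mul_nonneg (by linarith) (by linarith)
  refine le_of_mul_le_mul_left ?_ (by linarith : 0 < 2 * t - 1)
  calc (2 * t - 1) * ((x - 8 / 3) * (y + 5 / 2))
      ≤ 6 * (2 - t) * ((x - 8 / 3) * (y + 5 / 2)) := by gcongr; linarith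
    _ ≤ 6 * (2 - t) * ((x - (t + 1)) * (y + (t + 1))) := by gcongr; linarith
    _ = (2 * t - 1) * (3 * hurwitzValue x y * (x * y + 1)) := by
      rw [hfactor] at hval
      linear_combination -3 * hval

theorem hurwitzValue_pos (hx : 8 / 3 < x) (hy : 0 ≤ y) : 0 < hurwitzValue x y := by
  have hprod : 0 < (x - 8 / 3) * (y + 5 / 2) := mul_pos (sub_pos.mpr hx) (by linarith)
  have hle := hprod.trans_le (le_hurwitzValue_mul hx.le hy)
  have := pos_of_mul_pos_left hle (by positivity)
  linarith

end HurwitzValue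

namespace IsAlternatingCF

variable {u v : ℕ} {x y : ℝ}

theorem one_add_hurwitzValue_mul_sub (h : IsAlternatingCF u v x y) :
    (1 + hurwitzValue x y) * ((φ - ψ) * (v * (x - (u - x)))) = 3 * u * v + 2 * u - 2 * v := by
  have hx := h.left_pos
  have hy := h.right_pos
  have hu : (u : ℝ) = (x * y - 1) / y := by rw [eq_div_iff hy.ne', h.quot_left_mul]
  have hv : (v : ℝ) = (x * y - 1) / x := by rw [eq_div_iff hx.ne', h.quot_right_mul]
  have hval := one_add_hurwitzValue_mul (x := x) (y := y) (by positivity)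
  rw [Real.goldenRatio_sub_goldenConj] at hval ⊢
  rw [h.quot_left_sub, hu, hv]
  field_simp
  linear_combination (x * y - 1) * hval

theorem two_mul_le_mul_sub (h : IsAlternatingCF u v x y) (hu : 9 ≤ u) (huv : u ≤ v) :
    2 * (u * v + u) ≤ (φ - ψ) * (v * (x - (u - x))) := by
  have hdiff : 0 ≤ x - (u - x) := by linarith [h.quot_left_lt, h.left_pos]
  have hsq : ((φ - ψ) * (v * (x - (u - x)))) ^ 2 = 5 * (u ^ 2 * v ^ 2 + 4 * u * v) := by
    rw [mul_pow, Real.goldenRatio_sub_goldenConj, Real.sq_sqrt (by norm_num)]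
    linear_combination -20 * (v : ℝ) * h.mul_quot_left_sub
  have hu' : (9 : ℝ) ≤ u := by exact_mod_cast hu
  have huv' : (u : ℝ) ≤ v := by exact_mod_cast huv
  refine abs_le_of_sq_le_sq' ?_ ?_ |>.2
  · rw [hsq]
    have hmul : 9 * (u : ℝ) ^ 2 * v ≤ u ^ 2 * v ^ 2 := by
      nlinarith [mul_le_mul_of_nonneg_left (hu'.trans huv') (by positivity : 0 ≤ (u : ℝ) ^ 2 * v)]
    nlinarith
  · rw [Real.goldenRatio_sub_goldenConj]
    positivity

/-- The right-hand side is, up to scaling, a pairing plus or minus `T`, and the gap of the pairing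
keeps its absolute value away from `T`. -/
theorem hurwitzValue_mul_le_abs_pairing_add (h : IsAlternatingCF u v x y) (hu : 9 ≤ u)
    (huv : u ≤ v) {p q r e : ℤ} (hdisc : q ^ 2 - 4 * p * r = 5) (he : IsUnit e) {T : ℝ}
    (hT : T = (φ - ψ) * (v * (x - (u - x)))) :
    hurwitzValue x y * T ≤ |pairing u v p q r + e * T| := by
  have hgapT := h.one_add_hurwitzValue_mul_sub
  have hTle := h.two_mul_le_mul_sub hu huv
  rw [← hT] at hgapT hTle
  have hTpos : 0 ≤ T := le_trans (by positivity) hTle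
  have habs : |e * T| = T := by
    have : |(e : ℝ)| = 1 := mod_cast Int.isUnit_iff_abs_eq.mp he
    rw [abs_mul, this, one_mul, abs_of_nonneg hTpos]
  rcases pairing_gap (u := u) (v := v) (mod_cast hu) (mod_cast huv) hdisc with hgap | hgap
  · have hgap' : 3 * u * v + 2 * u - 2 * v ≤ |(pairing u v p q r : ℝ)| := by exact_mod_cast hgap
    linarith [abs_sub_abs_le_abs_add (pairing u v p q r : ℝ) (e * T)]
  · have hgap' : |(pairing u v p q r : ℝ)| ≤ u * v + 2 * u + 2 * v := by exact_mod_cast hgap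
    rw [add_comm (pairing u v p q r : ℝ)]
    linarith [abs_sub_abs_le_abs_add (e * T) (pairing u v p q r : ℝ)]

theorem hurwitzValue_mul_abs_fracLin_sub_le (h : IsAlternatingCF u v x y) (hu : 9 ≤ u)
    (huv : u ≤ v) {A : Matrix (Fin 2) (Fin 2) ℤ} (hA : IsUnit A.det) :
    hurwitzValue x y * |φ - ψ| * |fracLin A x - fracLin A (u - x)| ≤
      2 * |fracLin A x - φ| * |fracLin A (u - x) - ψ| := by
  have hx := fracLinDenom_ne_zero hA.ne_zero h.isGaloisPair.irrational
  have hx' := fracLinDenom_ne_zero hA.ne_zero h.isGaloisPair.irrational_right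
  have hprod := mul_fracLin_sub_golden (u := u) (v := v) (by simp) (mod_cast h.mul_quot_left_sub)
    hx hx'
  simp only [Int.cast_natCast] at hprod
  have hdisc : (2 * A 0 0 * A 0 1 - A 0 0 * A 1 1 - A 0 1 * A 1 0 - 2 * A 1 0 * A 1 1) ^ 2 -
      4 * (A 0 0 ^ 2 - A 0 0 * A 1 0 - A 1 0 ^ 2) * (A 0 1 ^ 2 - A 0 1 * A 1 1 - A 1 1 ^ 2) =
        5 := by
    have hsq : A.det ^ 2 = 1 := Int.isUnit_sq hA
    rw [Matrix.det_fin_two] at hsq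
    linear_combination 5 * hsq
  have hle := h.hurwitzValue_mul_le_abs_pairing_add hu huv hdisc hA rfl
  have hpos : 0 < v * |fracLinDenom A x * fracLinDenom A (u - x)| :=
    mul_pos (Nat.cast_pos.mpr h.quot_right_pos) (abs_pos.mpr (mul_ne_zero hx hx'))
  have hφψ : |φ - ψ| = φ - ψ := abs_of_pos (by simp [Real.goldenRatio_sub_goldenConj])
  have hdiff : |x - (u - x)| = x - (u - x) :=
    abs_of_nonneg (by linarith [h.quot_left_lt, h.left_pos])
  have hright : 2 * |fracLin A x - φ| * |fracLin A (u - x) - ψ| *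
      (v * |fracLinDenom A x * fracLinDenom A (u - x)|) =
      |2 * v * ((fracLin A x - φ) * (fracLin A (u - x) - ψ)) *
        (fracLinDenom A x * fracLinDenom A (u - x))| := by
    simp only [abs_mul, abs_two, Nat.abs_cast]
    ring
  refine le_of_mul_le_mul_right ?_ hpos
  calc _ = hurwitzValue x y * ((φ - ψ) * (v * (x - (u - x)))) := by
        rw [abs_fracLin_sub_fracLin hA hx hx', hφψ, hdiff]
        field_simp
    _ ≤ _ := hle
    _ = _ := by rw [hright, hprod]

end IsAlternatingCF

theorem le_approxConst_of_forall {α ξ ξ' K : ℝ} (hξ : ξ ≠ ξ')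
    (h : ∀ β ∈ orbitTheta α, β ≠ galConj β ∧
      K * |ξ - ξ'| * |β - galConj β| ≤ 2 * |β - ξ| * |galConj β - ξ'|) :
    (K : EReal) ≤ approxConst α ξ := by
  refine EReal.ge_of_forall_gt_iff_ge.mp fun c hc => ?_
  have hcK : c < K := by exact_mod_cast hc
  have hξpos : 0 < |ξ - ξ'| := abs_pos.mpr (sub_ne_zero.mpr hξ)
  have hev : ∀ᶠ δ : ℝ in 𝓝 0, c * (|ξ - ξ'| + δ + c * δ / 2) < K * |ξ - ξ'| := by
    have hcont : Continuous fun δ : ℝ => c * (|ξ - ξ'| + δ + c * δ / 2) := by fun_prop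
    refine (hcont.tendsto 0).eventually_lt_const ?_
    simpa using mul_lt_mul_of_pos_right hcK hξpos
  refine le_liminf_of_le (by isBoundedDefault) (eventually_inf_principal.mpr ?_)
  refine (hev.comap fun β : ℝ => |β - galConj β|).mono fun β hβ hmem => ?_
  obtain ⟨hne, hle⟩ := h β hmem
  have hδ : 0 < |β - galConj β| := abs_pos.mpr (sub_ne_zero.mpr hne)
  rw [EReal.coe_le_coe_iff, ← mul_div_assoc, abs_sub_comm ξ β]
  by_contra! hcon
  rw [div_lt_iff₀ hδ] at hcon
  have hconj : |galConj β - ξ'| ≤ |ξ - ξ'| + |β - galConj β| + c * |β - galConj β| / 2 := by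
    have htri := abs_add_three (galConj β - β) (β - ξ) (ξ - ξ')
    rw [show galConj β - β + (β - ξ) + (ξ - ξ') = galConj β - ξ' by ring,
      abs_sub_comm (galConj β) β] at htri
    linarith
  refine absurd hle (not_le.mpr ?_)
  calc 2 * |β - ξ| * |galConj β - ξ'|
      ≤ c * |β - galConj β| * (|ξ - ξ'| + |β - galConj β| + c * |β - galConj β| / 2) := by
        gcongr
        exact (mul_nonneg zero_le_two (abs_nonneg _)).trans hcon.le
    _ = c * (|ξ - ξ'| + |β - galConj β| + c * |β - galConj β| / 2) * |β - galConj β| := by ring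
    _ < K * |ξ - ξ'| * |β - galConj β| := mul_lt_mul_of_pos_right hβ hδ

end LowerBound

section ContinuedFraction

/-- The complete quotients `X₀ = ξ`, `Xₙ₊₁ = 1 / (Xₙ - ⌊Xₙ⌋)` of the continued fraction of `ξ`. -/
noncomputable def completeQuotient (ξ : ℝ) : ℕ → ℝ
  | 0 => ξ
  | n + 1 => (Int.fract (completeQuotient ξ n))⁻¹

/-- The matrix `!![pₙ₋₁, pₙ₋₂; qₙ₋₁, qₙ₋₂]` of numerators and denominators of convergents of `ξ`,
which sends the complete quotient `Xₙ` to `ξ`. -/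
noncomputable def convergentMatrix (ξ : ℝ) : ℕ → Matrix (Fin 2) (Fin 2) ℤ
  | 0 => 1
  | n + 1 => convergentMatrix ξ n * !![⌊completeQuotient ξ n⌋, 1; 1, 0]

/-- The ratio `qₙ₋₂ / qₙ₋₁` of consecutive denominators of convergents of `ξ`, with the junk
value `1 / 0 = 0` for `n = 0`. -/
noncomputable def denomRatio (ξ : ℝ) (n : ℕ) : ℝ :=
  convergentMatrix ξ n 1 1 / convergentMatrix ξ n 1 0

variable {ξ : ℝ}

theorem fract_completeQuotient (ξ : ℝ) (n : ℕ) :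
    Int.fract (completeQuotient ξ n) = (completeQuotient ξ (n + 1))⁻¹ := by
  rw [completeQuotient, inv_inv]

theorem irrational_completeQuotient (hξ : Irrational ξ) (n : ℕ) :
    Irrational (completeQuotient ξ n) := by
  induction n with
  | zero => exact hξ
  | succ n ih => exact (ih.sub_intCast ⌊completeQuotient ξ n⌋).inv

theorem one_lt_completeQuotient_succ (hξ : Irrational ξ) (n : ℕ) :
    1 < completeQuotient ξ (n + 1) := by
  have hfract : Irrational (Int.fract (completeQuotient ξ n)) :=
    (irrational_completeQuotient hξ n).sub_intCast _
  exact one_lt_inv_iff₀.mpr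
    ⟨(Int.fract_nonneg _).lt_of_ne hfract.ne_zero.symm, Int.fract_lt_one _⟩

theorem one_le_floor_completeQuotient_succ (hξ : Irrational ξ) (n : ℕ) :
    1 ≤ ⌊completeQuotient ξ (n + 1)⌋ :=
  Int.le_floor.mpr (mod_cast (one_lt_completeQuotient_succ hξ n).le)

theorem isUnit_det_convergentMatrix (ξ : ℝ) (n : ℕ) : IsUnit (convergentMatrix ξ n).det := by
  induction n with
  | zero => simp [convergentMatrix]
  | succ n ih =>
    rw [convergentMatrix, Matrix.det_mul]
    exact ih.mul (by simp [Matrix.det_fin_two_of])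

theorem fracLin_convergentMatrix (hξ : Irrational ξ) (n : ℕ) :
    fracLin (convergentMatrix ξ n) (completeQuotient ξ n) = ξ := by
  induction n with
  | zero => simp [convergentMatrix, completeQuotient, fracLin, fracLinDenom]
  | succ n ih =>
    have hne : completeQuotient ξ (n + 1) ≠ 0 :=
      (zero_lt_one.trans (one_lt_completeQuotient_succ hξ n)).ne'
    have hstep : fracLin !![⌊completeQuotient ξ n⌋, 1; 1, 0] (completeQuotient ξ (n + 1)) =
        completeQuotient ξ n := by
      simp only [fracLin, fracLinDenom, Matrix.of_apply, Matrix.cons_val', Matrix.cons_val_zero,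
        Matrix.cons_val_one, Matrix.cons_val_fin_one, Int.cast_one, Int.cast_zero, one_mul,
        add_zero]
      rw [add_div, mul_div_cancel_right₀ _ hne, one_div, ← fract_completeQuotient,
        Int.floor_add_fract]
    rw [convergentMatrix, fracLin_mul (by simpa [fracLinDenom] using hne), hstep, ih]

theorem convergentMatrix_succ_one_one (ξ : ℝ) (n : ℕ) :
    convergentMatrix ξ (n + 1) 1 1 = convergentMatrix ξ n 1 0 := by
  simp [convergentMatrix, Matrix.mul_apply]

theorem convergentMatrix_succ_one_zero (ξ : ℝ) (n : ℕ) :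
    convergentMatrix ξ (n + 1) 1 0 =
      convergentMatrix ξ n 1 0 * ⌊completeQuotient ξ n⌋ + convergentMatrix ξ n 1 1 := by
  simp [convergentMatrix, Matrix.mul_apply]

theorem fib_le_convergentMatrix (hξ : Irrational ξ) (n : ℕ) :
    (Nat.fib n : ℤ) ≤ convergentMatrix ξ n 1 0 := by
  induction n using Nat.twoStepInduction with
  | zero => simp [convergentMatrix]
  | one => simp [convergentMatrix]
  | more n ih ih' =>
    have hfloor := one_le_floor_completeQuotient_succ hξ n
    rw [convergentMatrix_succ_one_zero, convergentMatrix_succ_one_one, Nat.fib_add_two]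
    push_cast
    nlinarith [Int.natCast_nonneg (Nat.fib (n + 1))]

theorem convergentMatrix_one_zero_pos (hξ : Irrational ξ) (n : ℕ) :
    0 < convergentMatrix ξ (n + 1) 1 0 :=
  (mod_cast Nat.fib_pos.mpr n.succ_pos : (0 : ℤ) < Nat.fib (n + 1)).trans_le
    (fib_le_convergentMatrix hξ _)

theorem tendsto_convergentMatrix_one_zero (hξ : Irrational ξ) :
    Tendsto (fun n => (convergentMatrix ξ n 1 0 : ℝ)) atTop atTop := by
  refine tendsto_atTop_mono (f := fun n : ℕ => (n : ℝ) - 1) (fun n => ?_)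
    (tendsto_atTop_add_const_right _ _ tendsto_natCast_atTop_atTop)
  have hfib : (n : ℤ) ≤ Nat.fib n + 1 := mod_cast Nat.le_fib_add_one n
  exact_mod_cast (by linarith [fib_le_convergentMatrix hξ n] :
    (n : ℤ) - 1 ≤ convergentMatrix ξ n 1 0)

theorem denomRatio_succ_succ (hξ : Irrational ξ) (n : ℕ) :
    denomRatio ξ (n + 2) =
      (⌊completeQuotient ξ (n + 1)⌋ + denomRatio ξ (n + 1))⁻¹ := by
  have hpos : (convergentMatrix ξ (n + 1) 1 0 : ℝ) ≠ 0 :=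
    mod_cast (convergentMatrix_one_zero_pos hξ n).ne'
  rw [denomRatio, denomRatio, convergentMatrix_succ_one_one ξ (n + 1),
    convergentMatrix_succ_one_zero ξ (n + 1)]
  push_cast
  field_simp

theorem denomRatio_mem_Icc (hξ : Irrational ξ) (n : ℕ) : denomRatio ξ n ∈ Set.Icc 0 1 := by
  match n with
  | 0 => simp [denomRatio, convergentMatrix]
  | 1 => simp [denomRatio, convergentMatrix]
  | n + 2 =>
    have hfloor : (1 : ℝ) ≤ ⌊completeQuotient ξ (n + 1)⌋ :=
      mod_cast one_le_floor_completeQuotient_succ hξ n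
    have ih := (denomRatio_mem_Icc hξ (n + 1)).1
    rw [denomRatio_succ_succ hξ]
    exact ⟨by positivity, inv_le_one_of_one_le₀ (by linarith)⟩

theorem fracLinDenom_convergentMatrix (hξ : Irrational ξ) {n : ℕ} (hn : n ≠ 0) (z : ℝ) :
    fracLinDenom (convergentMatrix ξ n) z = convergentMatrix ξ n 1 0 * (z + denomRatio ξ n) := by
  obtain ⟨n, rfl⟩ := Nat.exists_eq_succ_of_ne_zero hn
  have hpos : (convergentMatrix ξ (n + 1) 1 0 : ℝ) ≠ 0 :=
    mod_cast (convergentMatrix_one_zero_pos hξ n).ne'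
  rw [fracLinDenom, denomRatio, mul_add, mul_div_cancel₀ _ hpos]

end ContinuedFraction

section Approximants

/-- Some `b ∈ Θ_α` approximates a complete quotient `X` of a number `ξ`, whose ratio of
denominators of convergents is `η`, so well that its image `β` under the convergent matrix satisfies
`2 * |ξ - β| / |β - β^σ| ≤ C`; the bound by `W` forces `|β - β^σ|` to be small. -/
def HasApproximant (α W X η C : ℝ) : Prop :=
  ∃ b ∈ orbitTheta α, |b - galConj b| ≤ W * |(b + η) * (galConj b + η)| ∧
    2 * (|X - b| * |galConj b + η|) ≤ C * ((X + η) * |b - galConj b|)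

theorem HasApproximant.mono {α W X η C C' : ℝ} (h : HasApproximant α W X η C) (hX : 0 ≤ X + η)
    (hC : C ≤ C') : HasApproximant α W X η C' := by
  obtain ⟨b, hb, hW, hle⟩ := h
  exact ⟨b, hb, hW, hle.trans (by gcongr)⟩

variable {α α' W ξ K C : ℝ} {m : ℤ}

theorem HasApproximant.exists_near (hα : IsGaloisPair α α') (hm : α + α' = m)
    (hξ : Irrational ξ) {n : ℕ} (hn : n ≠ 0)
    (h : HasApproximant α W (completeQuotient ξ n) (denomRatio ξ n) C) :
    ∃ β ∈ orbitTheta α, |β - galConj β| ≤ W / (convergentMatrix ξ n 1 0 : ℝ) ^ 2 ∧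
      2 * (|ξ - β| / |β - galConj β|) ≤ C := by
  obtain ⟨b, hb, hW, hle⟩ := h
  have hdet := isUnit_det_convergentMatrix ξ n
  have hpair := isGaloisPair_of_mem_orbitTheta hα hm hb
  have hDX := fracLinDenom_ne_zero hdet.ne_zero (irrational_completeQuotient hξ n)
  have hDb := fracLinDenom_ne_zero hdet.ne_zero hpair.irrational
  have hDb' := fracLinDenom_ne_zero hdet.ne_zero hpair.irrational_right
  have hX : 0 < completeQuotient ξ n + denomRatio ξ n := by
    obtain ⟨k, rfl⟩ := Nat.exists_eq_succ_of_ne_zero hn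
    linarith [one_lt_completeQuotient_succ hξ k, (denomRatio_mem_Icc hξ (k + 1)).1]
  refine ⟨fracLin (convergentMatrix ξ n) b, fracLin_mem_orbitTheta hα hm hdet hb, ?_⟩
  rw [(hpair.map_fracLin hdet.ne_zero).galConj_eq]
  constructor
  · rw [abs_fracLin_sub_fracLin hdet hDb hDb', div_le_iff₀ (abs_pos.mpr (mul_ne_zero hDb hDb'))]
    rw [fracLinDenom_convergentMatrix hξ hn, fracLinDenom_convergentMatrix hξ hn] at *
    have hq := left_ne_zero_of_mul hDb
    rw [mul_mul_mul_comm, abs_mul, abs_mul_self, ← mul_assoc, ← sq,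
      div_mul_cancel₀ _ (pow_ne_zero 2 hq)]
    exact hW
  · have hq : |(convergentMatrix ξ n 1 0 : ℝ)| ≠ 0 := by
      rw [fracLinDenom_convergentMatrix hξ hn] at hDb
      exact abs_ne_zero.mpr (left_ne_zero_of_mul hDb)
    nth_rw 1 [← fracLin_convergentMatrix hξ n]
    rw [abs_fracLin_sub_div_abs_fracLin_sub hdet hDX hDb hDb',
      fracLinDenom_convergentMatrix hξ hn, fracLinDenom_convergentMatrix hξ hn, abs_mul, abs_mul,
      abs_of_pos hX, mul_left_comm, mul_assoc, mul_div_mul_left _ _ hq, ← mul_div_assoc,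
      div_le_iff₀ (mul_pos hX (abs_pos.mpr (sub_ne_zero.mpr hpair.ne)))]
    exact hle

theorem approxConst_le_of_frequently_hasApproximant (hα : IsGaloisPair α α') (hm : α + α' = m)
    (hξ : Irrational ξ) (h : ∀ ε > 0, ∃ᶠ n in atTop,
      HasApproximant α W (completeQuotient ξ n) (denomRatio ξ n) (K + ε)) :
    approxConst α ξ ≤ K := by
  refine EReal.le_of_forall_lt_iff_le.mp fun z hz => liminf_le_of_frequently_le' ?_
  have hKz : K < z := by exact_mod_cast hz
  rw [((Metric.nhds_basis_ball.comap fun β : ℝ => |β - galConj β|).inf_principal _).frequently_iff]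
  intro ε hε
  have hsmall : ∀ᶠ n in atTop, W / (convergentMatrix ξ n 1 0 : ℝ) ^ 2 < ε :=
    (((tendsto_pow_atTop two_ne_zero).comp
      (tendsto_convergentMatrix_one_zero hξ)).const_div_atTop W).eventually_lt_const hε
  obtain ⟨n, happ, hn, hlt⟩ :=
    ((h (z - K) (sub_pos.mpr hKz)).and_eventually ((eventually_ne_atTop 0).and hsmall)).exists
  obtain ⟨β, hβ, hdist, hle⟩ := happ.exists_near hα hm hξ hn
  refine ⟨β, ⟨?_, hβ⟩, ?_⟩
  · simpa using hdist.trans_lt hlt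
  · rw [add_sub_cancel] at hle
    exact_mod_cast hle

end Approximants

section UpperBound

theorem hasApproximant_of_mem {α W X η C s t : ℝ} {k : ℤ} (hs : s ≠ 0) (hst : 0 ≤ s * t)
    (hmem : k + 1 / s ∈ orbitTheta α ∧ galConj (k + 1 / s) = k - t) (hW : |1 / s + t| ≤ W)
    (hleft : 1 ≤ |k + 1 / s + η|) (hright : 1 ≤ |k - t + η|)
    (hle : 2 * (|(X - k) * s - 1| * |k - t + η|) ≤ C * ((X + η) * (s * t + 1))) :
    HasApproximant α W X η C := by
  have hW0 : 0 ≤ W := (abs_nonneg _).trans hW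
  have hdist : k + 1 / s - (k - t) = (s * t + 1) / s := by
    field_simp
    ring
  have hsub : X - (k + 1 / s) = ((X - k) * s - 1) / s := by
    field_simp
    ring
  refine ⟨k + 1 / s, hmem.1, ?_, ?_⟩
  · rw [hmem.2, add_sub_sub_cancel, abs_mul]
    exact hW.trans (le_mul_of_one_le_right hW0 (one_le_mul_of_one_le_of_one_le hleft hright))
  · rw [hmem.2, hdist, hsub, abs_div, abs_div, abs_of_nonneg (by linarith : 0 ≤ s * t + 1)]
    calc 2 * (|(X - k) * s - 1| / |s| * |k - t + η|)
        = 2 * (|(X - k) * s - 1| * |k - t + η|) / |s| := by ring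
      _ ≤ C * ((X + η) * (s * t + 1)) / |s| := by gcongr
      _ = C * ((X + η) * ((s * t + 1) / |s|)) := by ring

/-- Both sides are affine in `δ` once the sign is fixed, and `hupper` and `hlower` are the cases
`δ = 1 / 2` and `δ = -1 / 2`. -/
theorem abs_mul_add_one_mul_le {x y δ : ℝ} (hx : 9 ≤ x) (hy : 9 ≤ y) (hδ : |δ| ≤ 1 / 2) :
    6 * |δ * x + 1| * (7 + y) ≤ (x - 8 / 3) * (y + 5 / 2) * (7 + δ) := by
  obtain ⟨hδ₁, hδ₂⟩ := abs_le.mp hδ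
  have hxy : 0 ≤ (x - 9) * (y - 9) := mul_nonneg (by linarith) (by linarith)
  have hupper : (x + 2) * (7 + y) ≤ 5 / 2 * ((x - 8 / 3) * (y + 5 / 2)) := by linarith
  have hlower : (x - 2) * (7 + y) ≤ 13 / 6 * ((x - 8 / 3) * (y + 5 / 2)) := by linarith
  rcases abs_cases (δ * x + 1) with ⟨habs, -⟩ | ⟨habs, -⟩ <;> rw [habs] <;>
    nlinarith [mul_le_mul_of_nonneg_right hupper (by linarith : 0 ≤ 1 / 2 + δ),
      mul_le_mul_of_nonneg_right hlower (by linarith : 0 ≤ 1 / 2 - δ)]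

namespace IsAlternatingCF

variable {u v : ℕ} {x y X η : ℝ} {k : ℤ}

theorem hasApproximant_left (h : IsAlternatingCF u v x y) (hx : 9 ≤ x) (hy : 9 ≤ y)
    (hη : η ∈ Set.Icc 0 1) (hk : k ∈ Set.Icc 2 7)
    (hle : 6 * |(X - k) * x - 1| ≤ (x - 8 / 3) * (X + η)) :
    HasApproximant x (x + y) X η (hurwitzValue x y) := by
  obtain ⟨hη0, hη1⟩ := hη
  have hk2 : (2 : ℝ) ≤ k := mod_cast hk.1
  have hk7 : (k : ℝ) ≤ 7 := mod_cast hk.2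
  have hinv : 1 / x ∈ Set.Ioc 0 1 :=
    ⟨by positivity, (div_le_one (by linarith)).mpr (by linarith)⟩
  have hXη : 0 ≤ X + η := nonneg_of_mul_nonneg_right ((by positivity : (0 : ℝ) ≤ _).trans hle)
    (by linarith)
  have hval := le_hurwitzValue_mul (x := x) (y := y) (by linarith) (by linarith)
  have hright : |k - y + η| = y - k - η := by
    rw [abs_of_nonpos (by linarith)]
    ring
  refine hasApproximant_of_mem (by positivity) (by positivity) (h.intCast_add_inv_left_mem k)
    ?_ ?_ (by linarith) ?_
  · rw [abs_of_nonneg (by linarith [hinv.1])]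
    linarith [hinv.2]
  · rw [abs_of_nonneg] <;> linarith [hinv.1]
  · rw [hright]
    have hmul : 6 * |(X - k) * x - 1| * (y - k - η) ≤
        (x - 8 / 3) * (X + η) * (y + 5 / 2) :=
      mul_le_mul hle (by linarith) (by linarith) (mul_nonneg (by linarith) hXη)
    linarith [mul_le_mul_of_nonneg_right hval hXη]

theorem hasApproximant_right (h : IsAlternatingCF u v x y) (hx : 9 ≤ x) (hy : 9 ≤ y)
    (hη : η ∈ Set.Icc 0 1) (hk : k ∈ Set.Icc 3 7) (hX : X ≤ k)
    (hle : 6 * (k - X) ≤ X + η) :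
    HasApproximant x (x + y) X η (hurwitzValue x y) := by
  obtain ⟨hη0, hη1⟩ := hη
  have hk3 : (3 : ℝ) ≤ k := mod_cast hk.1
  have hk7 : (k : ℝ) ≤ 7 := mod_cast hk.2
  have hinv : 1 / y ∈ Set.Ioc 0 1 :=
    ⟨by positivity, (div_le_one (by linarith)).mpr (by linarith)⟩
  have hval := le_hurwitzValue_mul (x := x) (y := y) (by linarith) (by linarith)
  have hright : |k - x + η| = x - k - η := by
    rw [abs_of_nonpos (by linarith)]
    ring
  have hleft : |(X - k) * y - 1| = (k - X) * y + 1 := by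
    rw [abs_of_nonpos (by linarith [mul_nonneg (sub_nonneg.mpr hX) h.right_pos.le])]
    ring
  refine hasApproximant_of_mem (by positivity) (by positivity) (h.intCast_add_inv_right_mem k)
    ?_ ?_ (by linarith) ?_
  · rw [abs_of_nonneg (by linarith [hinv.1])]
    linarith [hinv.2]
  · rw [abs_of_nonneg] <;> linarith [hinv.1]
  · rw [hright, hleft]
    have hle' : 6 * ((k - X) * y + 1) ≤ (X + η) * (y + 5 / 2) := by
      linarith [mul_le_mul_of_nonneg_right hle h.right_pos.le]
    have hmul : 6 * ((k - X) * y + 1) * (x - k - η) ≤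
        (X + η) * (y + 5 / 2) * (x - 8 / 3) :=
      mul_le_mul hle' (by linarith) (by linarith) (mul_nonneg (by linarith) (by linarith))
    linarith [mul_le_mul_of_nonneg_right hval (by linarith : 0 ≤ X + η)]

theorem hasApproximant_of_seven_le (h : IsAlternatingCF u v x y) (hx : 9 ≤ x) (hy : 9 ≤ y)
    (hη : 0 ≤ η) (hk : 7 ≤ k) (hX : |X - k| ≤ 1 / 2) :
    HasApproximant x (x + y) X η (hurwitzValue x y) := by
  obtain ⟨hX₁, hX₂⟩ := abs_le.mp hX
  have hk7 : (7 : ℝ) ≤ k := mod_cast hk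
  have hinv : 1 / x ∈ Set.Ioc 0 1 :=
    ⟨by positivity, (div_le_one (by linarith)).mpr (by linarith)⟩
  have hval := le_hurwitzValue_mul (x := x) (y := y) (by linarith) (by linarith)
  have hright : |k - -y + η| = k + η + y := by
    rw [abs_of_nonneg (by linarith)]
    ring
  have hleft : |(X - k) * -x - 1| = |(X - k) * x + 1| := by rw [← abs_neg, neg_sub]; ring_nf
  refine hasApproximant_of_mem (k := k) (s := -x) (t := -y) (by linarith) (by nlinarith)
    (by simpa [div_neg, sub_eq_add_neg] using h.intCast_sub_inv_left_mem k) ?_ ?_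
    (by linarith) ?_
  · rw [div_neg, ← neg_add, abs_neg, abs_of_nonneg (by linarith [hinv.1])]
    linarith [hinv.2]
  · rw [div_neg, abs_of_nonneg] <;> linarith [hinv.2]
  · rw [hright, hleft, neg_mul_neg]
    have hshift : (k + η + y) * (7 + (X - k)) ≤ (7 + y) * (X + η) := by
      linarith [mul_nonneg (by linarith : 0 ≤ k + η - 7) (by linarith : 0 ≤ y - (X - k))]
    have hmul : 6 * |(X - k) * x + 1| * (k + η + y) ≤
        (x - 8 / 3) * (y + 5 / 2) * (X + η) := by
      refine le_of_mul_le_mul_right ?_ (by linarith : 0 < 7 + (X - k))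
      calc 6 * |(X - k) * x + 1| * (k + η + y) * (7 + (X - k))
          ≤ 6 * |(X - k) * x + 1| * ((7 + y) * (X + η)) := by
            rw [mul_assoc]
            gcongr
        _ = 6 * |(X - k) * x + 1| * (7 + y) * (X + η) := by ring
        _ ≤ (x - 8 / 3) * (y + 5 / 2) * (7 + (X - k)) * (X + η) :=
            mul_le_mul_of_nonneg_right (abs_mul_add_one_mul_le hx hy hX) (by linarith)
        _ = (x - 8 / 3) * (y + 5 / 2) * (X + η) * (7 + (X - k)) := by ring
    linarith [mul_le_mul_of_nonneg_right hval (by linarith : 0 ≤ X + η)]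

theorem hasApproximant_of_three_le (h : IsAlternatingCF u v x y) (hx : 9 ≤ x) (hy : 9 ≤ y)
    (hη : η ∈ Set.Icc 0 1) (hX : 3 ≤ X) :
    HasApproximant x (x + y) X η (hurwitzValue x y) := by
  have hround := abs_sub_round X
  obtain ⟨hlow, hupp⟩ := abs_le.mp hround
  have hη0 := hη.1
  have hk3 : 3 ≤ round X := by
    have : (2 : ℝ) < round X := by linarith
    exact_mod_cast this
  rcases le_total 7 (round X) with hk7 | hk7
  · exact h.hasApproximant_of_seven_le hx hy hη0 hk7 hround
  rcases le_total X (round X) with hle | hle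
  · exact h.hasApproximant_right hx hy hη ⟨hk3, hk7⟩ hle (by linarith)
  · refine h.hasApproximant_left (k := round X) hx hy hη ⟨by linarith, hk7⟩ ?_
    have hk3' : (3 : ℝ) ≤ round X := mod_cast hk3
    obtain ⟨δ, hδ⟩ : ∃ δ, δ = X - round X := ⟨_, rfl⟩
    have hXη : (x - 8 / 3) * (3 + δ) ≤ (x - 8 / 3) * (X + η) :=
      mul_le_mul_of_nonneg_left (by linarith) (by linarith)
    rw [← hδ]
    refine le_trans ?_ hXη
    rcases abs_cases (δ * x - 1) with ⟨habs, -⟩ | ⟨habs, -⟩ <;> rw [habs] <;> nlinarith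

theorem hasApproximant_of_mem_Icc (h : IsAlternatingCF u v x y) (hx : 9 ≤ x) (hy : 9 ≤ y)
    (hη : η ∈ Set.Icc (1 / 3) 1) (hX : X ∈ Set.Icc (7 / 3) (17 / 7) ∪ Set.Icc (18 / 7) 3) :
    HasApproximant x (x + y) X η (hurwitzValue x y) := by
  have hη' : η ∈ Set.Icc 0 1 := ⟨by linarith [hη.1], hη.2⟩
  rcases hX with ⟨hX₁, hX₂⟩ | ⟨hX₁, hX₂⟩
  · refine h.hasApproximant_left (k := 2) hx hy hη' (by simp) ?_
    rw [abs_of_nonneg] <;> push_cast <;> nlinarith [hη.1]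
  · exact h.hasApproximant_right (k := 3) hx hy hη' (by simp) (mod_cast hX₂)
      (by push_cast; linarith [hη.1])

end IsAlternatingCF

end UpperBound

section BoundedQuotients

variable {ξ : ℝ} {n : ℕ}

theorem one_third_le_fract_completeQuotient (hξ : Irrational ξ)
    (h : completeQuotient ξ (n + 1) < 3) : 1 / 3 ≤ Int.fract (completeQuotient ξ n) := by
  rw [fract_completeQuotient, one_div]
  exact inv_anti₀ (zero_lt_one.trans (one_lt_completeQuotient_succ hξ n)) h.le

theorem one_third_le_denomRatio (hξ : Irrational ξ) (h : completeQuotient ξ (n + 1) < 3) :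
    1 / 3 ≤ denomRatio ξ (n + 2) := by
  have hfloor : (⌊completeQuotient ξ (n + 1)⌋ : ℝ) ≤ 2 := by
    exact_mod_cast Int.lt_add_one_iff.mp (Int.floor_lt.mpr (by exact_mod_cast h))
  have hfloor1 : (1 : ℝ) ≤ ⌊completeQuotient ξ (n + 1)⌋ :=
    mod_cast one_le_floor_completeQuotient_succ hξ n
  obtain ⟨hη0, hη1⟩ := denomRatio_mem_Icc hξ (n + 1)
  rw [denomRatio_succ_succ hξ, one_div]
  exact inv_anti₀ (by linarith) (by linarith)

theorem four_thirds_le_completeQuotient_succ (hξ : Irrational ξ)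
    (h : completeQuotient ξ (n + 2) < 3) : 4 / 3 ≤ completeQuotient ξ (n + 1) := by
  have hfloor : (1 : ℝ) ≤ ⌊completeQuotient ξ (n + 1)⌋ :=
    mod_cast one_le_floor_completeQuotient_succ hξ n
  linarith [Int.floor_add_fract (completeQuotient ξ (n + 1)),
    one_third_le_fract_completeQuotient hξ h]

theorem completeQuotient_succ_le_or_le (hξ : Irrational ξ) (h₂ : completeQuotient ξ (n + 2) < 3)
    (h₃ : completeQuotient ξ (n + 3) < 3) :
    completeQuotient ξ (n + 1) ≤ 7 / 4 ∨ 7 / 3 ≤ completeQuotient ξ (n + 1) := by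
  have hadd := Int.floor_add_fract (completeQuotient ξ (n + 1))
  rcases (one_le_floor_completeQuotient_succ hξ n).eq_or_lt' with hone | htwo
  · left
    have hfract : Int.fract (completeQuotient ξ (n + 1)) ≤ (4 / 3)⁻¹ := by
      rw [fract_completeQuotient]
      exact inv_anti₀ (by norm_num) (four_thirds_le_completeQuotient_succ hξ h₃)
    rw [hone] at hadd
    norm_num at hadd hfract
    linarith
  · right
    have htwo' : (2 : ℝ) ≤ ⌊completeQuotient ξ (n + 1)⌋ := mod_cast htwo
    linarith [one_third_le_fract_completeQuotient hξ h₂]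

theorem completeQuotient_mem_Icc (hξ : Irrational ξ) (h₀ : completeQuotient ξ n ∈ Set.Ico 2 3)
    (h₁ : completeQuotient ξ (n + 1) < 3) (h₂ : completeQuotient ξ (n + 2) < 3)
    (h₃ : completeQuotient ξ (n + 3) < 3) :
    completeQuotient ξ n ∈ Set.Icc (7 / 3) (17 / 7) ∪ Set.Icc (18 / 7) 3 := by
  have hadd := Int.floor_add_fract (completeQuotient ξ n)
  have hfloor : ⌊completeQuotient ξ n⌋ = 2 :=
    Int.floor_eq_iff.mpr ⟨mod_cast h₀.1, by push_cast; linarith [h₀.2]⟩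
  rw [hfloor, Int.cast_ofNat] at hadd
  have hone := one_lt_completeQuotient_succ hξ n
  rcases completeQuotient_succ_le_or_le hξ h₂ h₃ with hle | hge
  · have hfract : (7 / 4)⁻¹ ≤ Int.fract (completeQuotient ξ n) := by
      rw [fract_completeQuotient]
      exact inv_anti₀ (by linarith) hle
    norm_num at hfract
    exact Or.inr ⟨by linarith, h₀.2.le⟩
  · have hfract : Int.fract (completeQuotient ξ n) ≤ (7 / 3)⁻¹ := by
      rw [fract_completeQuotient]
      exact inv_anti₀ (by norm_num) hge
    norm_num at hfract
    exact Or.inl ⟨by linarith [one_third_le_fract_completeQuotient hξ h₁], by linarith⟩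

end BoundedQuotients

section GoldenTail

variable {s : ℕ → ℝ}

/-- `φ⁻¹` is the fixed point of `t ↦ (1 + t)⁻¹`. -/
theorem abs_inv_one_add_sub_inv_golden_le {t : ℝ} (ht : 0 ≤ t) :
    |(1 + t)⁻¹ - φ⁻¹| ≤ φ⁻¹ * |t - φ⁻¹| := by
  have hfix : φ⁻¹ * (1 + φ⁻¹) = 1 := by
    rw [Real.inv_goldenRatio, ← sub_eq_add_neg, Real.one_sub_goldenRatio, neg_mul,
      Real.goldenConj_mul_goldenRatio, neg_neg]
  have hinv : (1 + t)⁻¹ * (1 + t) = 1 := inv_mul_cancel₀ (by positivity)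
  have hpos : 0 ≤ φ⁻¹ := inv_nonneg.mpr Real.goldenRatio_pos.le
  have hone : (1 + t)⁻¹ ≤ 1 := inv_le_one_of_one_le₀ (by linarith)
  have hsub : (1 + t)⁻¹ - φ⁻¹ = φ⁻¹ * ((1 + t)⁻¹ * (φ⁻¹ - t)) := by
    linear_combination φ⁻¹ * hinv - (1 + t)⁻¹ * hfix
  rw [hsub, abs_mul, abs_mul, abs_of_nonneg hpos, abs_of_nonneg (by positivity : 0 ≤ (1 + t)⁻¹),
    abs_sub_comm]
  exact mul_le_mul_of_nonneg_left (mul_le_of_le_one_left (abs_nonneg _) hone) hpos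

theorem tendsto_inv_golden_pow_mul (c : ℝ) :
    Tendsto (fun k : ℕ => φ⁻¹ ^ k * c) atTop (𝓝 0) := by
  have hlt : φ⁻¹ < 1 := inv_lt_one_of_one_lt₀ Real.one_lt_goldenRatio
  simpa using (tendsto_pow_atTop_nhds_zero_of_lt_one (inv_nonneg.mpr Real.goldenRatio_pos.le)
    hlt).mul_const c

theorem tendsto_inv_golden_of_succ_eq (hs : ∀ n, 0 ≤ s n)
    (hsucc : ∀ᶠ n in atTop, s (n + 1) = (1 + s n)⁻¹) : Tendsto s atTop (𝓝 φ⁻¹) := by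
  obtain ⟨N, hN⟩ := eventually_atTop.mp hsucc
  rw [← tendsto_add_atTop_iff_nat N, tendsto_iff_norm_sub_tendsto_zero]
  refine squeeze_zero (fun _ => norm_nonneg _) (fun k => ?_)
    (tendsto_inv_golden_pow_mul |s (0 + N) - φ⁻¹|)
  refine le_geom (u := fun k => |s (k + N) - φ⁻¹|) (inv_nonneg.mpr Real.goldenRatio_pos.le) k
    fun j _ => ?_
  rw [add_right_comm, hN _ (Nat.le_add_left N j)]
  exact abs_inv_one_add_sub_inv_golden_le (hs _)

theorem eventually_eq_inv_golden_of_eq_succ (hs : ∀ᶠ n in atTop, s n ∈ Set.Icc 0 1)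
    (hsucc : ∀ᶠ n in atTop, s n = (1 + s (n + 1))⁻¹) : ∀ᶠ n in atTop, s n = φ⁻¹ := by
  obtain ⟨N, hN⟩ := eventually_atTop.mp (hs.and hsucc)
  have hpos : 0 ≤ φ⁻¹ := inv_nonneg.mpr Real.goldenRatio_pos.le
  have hone : φ⁻¹ ≤ 1 := inv_le_one_of_one_le₀ Real.one_lt_goldenRatio.le
  have hbound : ∀ k n, N ≤ n → |s n - φ⁻¹| ≤ φ⁻¹ ^ k * 1 := by
    intro k
    induction k with
    | zero =>
      intro n hn
      rw [pow_zero, one_mul, abs_le]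
      constructor <;> linarith [(hN n hn).1.1, (hN n hn).1.2]
    | succ k ih =>
      intro n hn
      rw [(hN n hn).2, pow_succ', mul_assoc]
      exact (abs_inv_one_add_sub_inv_golden_le (hN (n + 1) (by omega)).1.1).trans
        (mul_le_mul_of_nonneg_left (ih (n + 1) (by omega)) hpos)
  filter_upwards [eventually_ge_atTop N] with n hn
  exact sub_eq_zero.mp (abs_nonpos_iff.mp
    (ge_of_tendsto' (tendsto_inv_golden_pow_mul 1) fun k => hbound k n hn))

variable {ξ : ℝ}

theorem eventually_floor_completeQuotient_eq_one (hξ : Irrational ξ)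
    (h : ∀ᶠ n in atTop, completeQuotient ξ n < 2) :
    ∀ᶠ n in atTop, ⌊completeQuotient ξ n⌋ = 1 := by
  filter_upwards [h, eventually_ne_atTop 0] with n hlt hn
  obtain ⟨n, rfl⟩ := Nat.exists_eq_succ_of_ne_zero hn
  exact Int.floor_eq_iff.mpr
    ⟨mod_cast (one_lt_completeQuotient_succ hξ n).le, by push_cast; linarith⟩

theorem tendsto_denomRatio_inv_golden (hξ : Irrational ξ)
    (h : ∀ᶠ n in atTop, completeQuotient ξ n < 2) :
    Tendsto (denomRatio ξ) atTop (𝓝 φ⁻¹) := by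
  refine tendsto_inv_golden_of_succ_eq (fun n => (denomRatio_mem_Icc hξ n).1) ?_
  filter_upwards [eventually_floor_completeQuotient_eq_one hξ h, eventually_ne_atTop 0]
    with n hfloor hn
  obtain ⟨n, rfl⟩ := Nat.exists_eq_succ_of_ne_zero hn
  rw [denomRatio_succ_succ hξ, hfloor, Int.cast_one]

theorem eventually_completeQuotient_eq_golden (hξ : Irrational ξ)
    (h : ∀ᶠ n in atTop, completeQuotient ξ n < 2) :
    ∀ᶠ n in atTop, completeQuotient ξ n = φ := by
  refine (eventually_eq_inv_golden_of_eq_succ (s := fun n => (completeQuotient ξ n)⁻¹) ?_ ?_).mono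
    fun n hn => inv_injective hn
  · filter_upwards [eventually_ne_atTop 0] with n hn
    obtain ⟨n, rfl⟩ := Nat.exists_eq_succ_of_ne_zero hn
    rw [← fract_completeQuotient]
    exact ⟨Int.fract_nonneg _, (Int.fract_lt_one _).le⟩
  · filter_upwards [eventually_floor_completeQuotient_eq_one hξ h] with n hfloor
    rw [← fract_completeQuotient, Int.fract, hfloor, Int.cast_one, add_sub_cancel]

end GoldenTail

namespace IsAlternatingCF

variable {u v : ℕ} {x y ξ ε β : ℝ}

theorem eventually_hasApproximant_golden (h : IsAlternatingCF u v x y) (hx : 9 ≤ x) (hy : 9 ≤ y)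
    (hε : 0 < ε) : ∀ᶠ η in 𝓝 φ⁻¹, HasApproximant x (x + y) φ η (hurwitzValue x y + ε) := by
  have hφ₁ := Real.one_lt_goldenRatio
  have hφ₂ := Real.goldenRatio_lt_two
  have hinv : φ⁻¹ = φ - 1 := by rw [Real.inv_goldenRatio, ← Real.one_sub_goldenConj, neg_sub]
  have hlt : 2 * (|(φ - 2) * y - 1| * |2 - x + φ⁻¹|) <
      (hurwitzValue x y + ε) * ((φ + φ⁻¹) * (y * x + 1)) := by
    have hval := hurwitzValue_mul (x := x) (y := y) (by positivity)
    have hpos : 0 < ε * ((φ + φ⁻¹) * (y * x + 1)) := by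
      have := Real.goldenRatio_pos
      positivity
    rw [Real.goldenRatio_sq, Real.goldenConj_sq, ← Real.one_sub_goldenConj] at hval
    rw [hinv] at hpos ⊢
    rw [abs_of_nonpos (by nlinarith), abs_of_nonpos (by linarith)]
    linarith
  have hleft : Continuous fun η : ℝ => 2 * (|(φ - 2) * y - 1| * |2 - x + η|) := by fun_prop
  have hright : Continuous fun η : ℝ =>
      (hurwitzValue x y + ε) * ((φ + η) * (y * x + 1)) := by fun_prop
  have hmem := h.intCast_add_inv_right_mem 2
  have hIcc : ∀ᶠ η in 𝓝 φ⁻¹, η ∈ Set.Icc 0 1 :=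
    Icc_mem_nhds (by linarith) (by linarith)
  filter_upwards [(hleft.tendsto _).eventually_lt (hright.tendsto _) hlt, hIcc] with η hη hη01
  have hinvy : 1 / y ∈ Set.Ioc 0 1 :=
    ⟨by positivity, (div_le_one (by linarith)).mpr (by linarith)⟩
  refine hasApproximant_of_mem (by positivity) (by positivity) hmem ?_ ?_ ?_
    (by exact_mod_cast hη.le)
  · rw [abs_of_nonneg] <;> linarith [hinvy.1, hinvy.2]
  · rw [abs_of_nonneg] <;> push_cast <;> linarith [hinvy.1, hη01.1]
  · rw [abs_of_nonpos] <;> push_cast <;> linarith [hη01.2]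

theorem frequently_hasApproximant (h : IsAlternatingCF u v x y) (hx : 9 ≤ x) (hy : 9 ≤ y)
    (hξ : Irrational ξ) (hε : 0 < ε) :
    ∃ᶠ n in atTop, HasApproximant x (x + y) (completeQuotient ξ n) (denomRatio ξ n)
      (hurwitzValue x y + ε) := by
  by_cases h₃ : ∃ᶠ n in atTop, 3 ≤ completeQuotient ξ n
  · refine h₃.mono fun n hn => ?_
    have hη := denomRatio_mem_Icc hξ n
    exact (h.hasApproximant_of_three_le hx hy hη hn).mono (by linarith [hη.1]) (by linarith)
  simp only [not_frequently, not_le] at h₃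
  by_cases h₂ : ∃ᶠ n in atTop, 2 ≤ completeQuotient ξ n
  · obtain ⟨N, hN⟩ := eventually_atTop.mp h₃
    refine (h₂.and_eventually (eventually_ge_atTop (N + 2))).mono ?_
    rintro n ⟨hn, hNn⟩
    obtain ⟨n, rfl⟩ := Nat.exists_eq_add_of_le' (le_of_add_le_right hNn)
    have hη := one_third_le_denomRatio hξ (hN (n + 1) (by omega))
    have hX := completeQuotient_mem_Icc hξ ⟨hn, hN _ (by omega)⟩ (hN _ (by omega))
      (hN _ (by omega)) (hN _ (by omega))
    exact (h.hasApproximant_of_mem_Icc hx hy ⟨hη, (denomRatio_mem_Icc hξ _).2⟩ hX).mono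
      (by linarith) (by linarith)
  simp only [not_frequently, not_le] at h₂
  refine Eventually.frequently ?_
  filter_upwards [eventually_completeQuotient_eq_golden hξ h₂,
    (tendsto_denomRatio_inv_golden hξ h₂).eventually
      (h.eventually_hasApproximant_golden hx hy hε)] with n hX happ
  rwa [hX]

theorem approxConst_le_hurwitzValue (h : IsAlternatingCF u v x y) (hx : 9 ≤ x) (hy : 9 ≤ y)
    (hξ : Irrational ξ) : approxConst x ξ ≤ hurwitzValue x y :=
  approxConst_le_of_frequently_hasApproximant h.isGaloisPair (m := u) (by simp) hξ
    fun _ hε => h.frequently_hasApproximant hx hy hξ hε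

theorem ne_galConj_and_hurwitzValue_mul_le (h : IsAlternatingCF u v x y) (hu : 9 ≤ u)
    (huv : u ≤ v) (hβ : β ∈ orbitTheta x) :
    β ≠ galConj β ∧
      hurwitzValue x y * |φ - ψ| * |β - galConj β| ≤ 2 * |β - φ| * |galConj β - ψ| := by
  obtain ⟨A, hA, rfl⟩ := (mem_orbitTheta_iff h.isGaloisPair (n := u) (by simp)).mp hβ
  have hpair := h.isGaloisPair.map_fracLin hA.ne_zero
  rw [hpair.galConj_eq]
  exact ⟨hpair.ne, h.hurwitzValue_mul_abs_fracLin_sub_le hu huv hA⟩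

theorem hurwitzValue_le_approxConst_goldenRatio (h : IsAlternatingCF u v x y) (hu : 9 ≤ u)
    (huv : u ≤ v) : hurwitzValue x y ≤ approxConst x φ :=
  le_approxConst_of_forall (sub_ne_zero.mp (by simp [Real.goldenRatio_sub_goldenConj]))
    fun _ hβ => h.ne_galConj_and_hurwitzValue_mul_le hu huv hβ

theorem goldenRatio_notMem_orbitTheta (h : IsAlternatingCF u v x y) (hu : 9 ≤ u)
    (huv : u ≤ v) : φ ∉ orbitTheta x := by
  intro hφ
  obtain ⟨hne, hle⟩ := h.ne_galConj_and_hurwitzValue_mul_le hu huv hφ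
  have hu' : (9 : ℝ) ≤ u := mod_cast hu
  have hpos := hurwitzValue_pos (by linarith [h.quot_left_lt] : 8 / 3 < x) h.right_pos.le
  have hφψ : φ - ψ ≠ 0 := by simp [Real.goldenRatio_sub_goldenConj]
  rw [sub_self, abs_zero, mul_zero, zero_mul] at hle
  exact hle.not_gt (mul_pos (mul_pos hpos (abs_pos.mpr hφψ)) (abs_pos.mpr (sub_ne_zero.mpr hne)))

end IsAlternatingCF

/-- For `v ≥ u ≥ 9`, the Hurwitz constant of `[u, v, u, v, …]` is given by the explicit formula,
and it is attained at the golden ratio. -/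
theorem theorem2 (u v : ℕ) (hu : 9 ≤ u) (huv : u ≤ v) (τ₁ τ₂ K : ℝ)
    (hτ₁ : τ₁ = betaCF u v) (hτ₂ : τ₂ = betaCF v u)
    (hK : K = 2 * (τ₁ - Real.goldenRatio ^ 2) * (1 + τ₂ / Real.goldenRatio ^ 2) /
      ((Real.goldenRatio + 1 / Real.goldenRatio) * (τ₁ * τ₂ + 1))) :
    IsHurwitzConstant (betaCF u v) K ∧
      approxConst τ₁ Real.goldenRatio = (K : EReal) ∧
      Irrational Real.goldenRatio ∧ Real.goldenRatio ∉ orbitTheta τ₁ := by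
  subst hτ₁ hτ₂
  obtain rfl : K = hurwitzValue (betaCF u v) (betaCF v u) := hK
  have hv : 9 ≤ v := hu.trans huv
  have hβ : IsAlternatingCF u v (betaCF u v) (betaCF v u) :=
    isAlternatingCF_betaCF (by omega) (by omega)
  have hupper {ξ : ℝ} (hξ : Irrational ξ) :
      approxConst (betaCF u v) ξ ≤ hurwitzValue (betaCF u v) (betaCF v u) :=
    hβ.approxConst_le_hurwitzValue ((mod_cast hu : (9 : ℝ) ≤ u).trans hβ.quot_left_lt.le)
      ((mod_cast hv : (9 : ℝ) ≤ v).trans hβ.symm.quot_left_lt.le) hξ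
  have hirr := Real.goldenRatio_irrational
  have hnotMem := hβ.goldenRatio_notMem_orbitTheta hu huv
  have hattained := (hupper hirr).antisymm (hβ.hurwitzValue_le_approxConst_goldenRatio hu huv)
  refine ⟨⟨⟨φ, hirr, hnotMem, hattained⟩, ?_⟩, hattained, hirr, hnotMem⟩
  rintro c ⟨ξ, hξ, -, rfl⟩
  exact hupper hξ
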